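/- **Setting.** Let $X$ be a locally finite tree (every edge has length $1$). An automorphism of $X$ is *elliptic* if it fixes a vertex, an *inversion* if it flips an edge, and *hyperbolic* otherwise. For elliptic $g$ let $T_g$ be its fixed subtree. For hyperbolic $g$ let $m_g=\min_v d(v,gv)>0$ be its translation length and let $A_g$, its axis, be the bi-infinite geodesic of vertices with $d(v,gv)=m_g$. For a subtree $S$ that is a path, ray, line or empty, $\ell(S)\in\{0,1,\dots,\infty\}$ is its number of edges. Two subtrees are called *disjoint* if they have no common edge (they may share a vertex). A group $G$ of automorphisms is *discrete* if the pointwise stabilizer in $G$ of some finite subtree is trivial. A pair $(g_1,g_2)$ of automorphisms is a *Schottky pair* if there are edges $e_i^\pm$ with $g_ie_i^-=e_i^+$ ($i=1,2$) and, for each of these four edges, a component $H_i^\pm$ of $X$ minus that edge, such that the four half-trees $H_i^\pm$ are pairwise disjoint (as vertex sets) and $g_i(X\setminus H_i^-)=e_i^+\cup H_i^+$ for $i=1,2$. Let $\gamma_1,\gamma_2$ be hyperbolic automorphisms of $X$ with translation lengths $m_1\ge m_2$, generating a group $\Gamma$ that is discrete and contains no inversion. Put $l=\ell(A_{\gamma_1}\cap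 A_{\gamma_2})$ and assume that, if $l>0$, then $\gamma_1$ and $\gamma_2$ translate in the same direction along $A_{\gamma_1}\cap A_{\gamma_2}$; if $0<l<\infty$, write this intersection as $[v^-,v^+]$, with both translating from $v^-$ toward $v^+$. As long as $m_{i+1}>0$, put $$q_i=\lfloor m_i/m_{i+1}\rfloor,\qquad m_{i+2}=m_i-q_im_{i+1},\qquad \gamma_{i+2}=\gamma_i\gamma_{i+1}^{-q_i},$$ and let $k$ be the first index with $m_{k+1}=0$ (so $m_k=\gcd(m_1,m_2)$). **Theorem.** Exactly one of the following cases (1)–(3) occurs. 1. $l=0$. Then $\Gamma$ is free of rank two and $(\gamma_1,\gamma_2)$ is a Schottky pair (with disjoint axes). 2. $0<l\le m_1+m_2-\gcd(m_1,m_2)$. Then there are unique integers $j,q$ with $1\le j\le k-1$, $0\le q\le q_j-1$ and $$(m_1+m_2)-m_j+(q-1)m_{j+1}<l\le (m_1+m_2)-m_j+q\,m_{j+1}.$$ (a) If $l=(m_1+m_2)-m_j+q\,m_{j+1}$, then $\gamma_j\gamma_{j+1}^{-q}$ is hyperbolic; put $l_0=\ell\big(A_{\gamma_j\gamma_{j+1}^{-q}}\cap\gamma_{j+1}A_{\gamma_j\gamma_{j+1}^{-q}}\big)$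 and $(\gamma_a,\gamma_b)=(\gamma_{j+1},\gamma_j\gamma_{j+1}^{-q-1})$. This pair generates $\Gamma$, and $\gamma_a$ is hyperbolic with translation length $m_{j+1}$. - (i) If $l_0\ge\frac{m_j-(q+1)m_{j+1}}2$, then $\Gamma$ is not free, $\gamma_b$ is elliptic, $A_{\gamma_a}$ and $T_{\gamma_b}$ are disjoint, and $d(A_{\gamma_a},T_{\gamma_b})=\frac{m_j-(q+1)m_{j+1}}2$. - (ii) If $l_0<\frac{m_j-(q+1)m_{j+1}}2$, then $\Gamma$ is free of rank two, $(\gamma_a,\gamma_b)$ is a Schottky pair, $\gamma_b$ is hyperbolic with translation length $m_j-(q+1)m_{j+1}-2l_0$, and the axes $A_{\gamma_a},A_{\gamma_b}$ are disjoint with $d(A_{\gamma_a},A_{\gamma_b})=l_0$. (b) If $l<(m_1+m_2)-m_j+q\,m_{j+1}$, put $(\gamma_a,\gamma_b)=(\gamma_{j+1},\gamma_j\gamma_{j+1}^{-q})$. Then $\Gamma$ is free of rank two, generated by the Schottky pair $(\gamma_a,\gamma_b)$; both are hyperbolic, with translation lengths $m_{j+1}$ and $m_j-q\,m_{j+1}$;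 and $A_{\gamma_a}\cap A_{\gamma_b}$ is a path of length $l-m_1-m_2+m_j-(q-1)m_{j+1}$ with $v^+$ as an endpoint. 3. $l>m_1+m_2-\gcd(m_1,m_2)$ (possibly $l=\infty$). Put $(\gamma_a,\gamma_b)=(\gamma_k,\gamma_{k+1})$. This pair generates $\Gamma$; $\gamma_a$ is hyperbolic with translation length $m_k$, $\gamma_b$ is elliptic, and $\ell(A_{\gamma_a}\cap T_{\gamma_b})=l-m_1-m_2+m_k$. The group $\Gamma$ is not free of rank two; it is free (then infinite cyclic, generated by $\gamma_a$) if and only if $\gamma_b=1$, and this does not happen if $l<\infty$. If $l<\infty$, then $A_{\gamma_a}\cap T_{\gamma_b}$ is a path with $v^+$ as an endpoint. -/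

import Mathlib

namespace TreeAut

variable {V : Type*} {X : SimpleGraph V}

/-- An automorphism is elliptic if it fixes a vertex. -/
def IsElliptic (g : X ≃g X) : Prop := ∃ v, g v = v

/-- An automorphism is an inversion if it flips an edge. -/
def IsInversion (g : X ≃g X) : Prop := ∃ u v, X.Adj u v ∧ g u = v ∧ g v = u

/-- An automorphism is hyperbolic if it fixes no vertex and inverts no edge. -/
def IsHyperbolic (g : X ≃g X) : Prop := ¬ IsElliptic g ∧ ¬ IsInversion g

/-- The minimal displacement `m_g = min_v d(v, g v)`. -/
noncomputable def translationLength (g : X ≃g X) : ℕ :=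
  sInf (Set.range fun v => X.dist v (g v))

/-- The axis `A_g` of a hyperbolic automorphism: the vertices of minimal displacement. -/
def axis (g : X ≃g X) : Set V := {v | X.dist v (g v) = translationLength g}

/-- The fixed subtree `T_g` of an elliptic automorphism. -/
def fixedTree (g : X ≃g X) : Set V := {v | g v = v}

/-- A group of automorphisms is discrete if the pointwise stabilizer in it of some finite
subtree is trivial. -/
def IsDiscrete (Γ : Subgroup (X ≃g X)) : Prop :=
  ∃ T : Set V, T.Finite ∧ (X.induce T).Connected ∧ ∀ g ∈ Γ, (∀ v ∈ T, g v = v) → g = 1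

/-- No element of the group is an inversion. -/
def InversionFree (Γ : Subgroup (X ≃g X)) : Prop := ∀ g ∈ Γ, ¬ IsInversion g

variable (X) in
/-- The length of a subtree with vertex set `S` that is a path, a ray, a line or empty: its number
of edges. It is `0` exactly when the subtree has no edge. -/
noncomputable def pathLength (S : Set V) : ℕ∞ := {e ∈ X.edgeSet | ∀ v ∈ e, v ∈ S}.encard

variable (X) in
/-- The distance between two (nonempty) sets of vertices. -/
noncomputable def setDist (S T : Set V) : ℕ := sInf {d | ∃ s ∈ S, ∃ t ∈ T, d = X.dist s t}

variable (X) in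
/-- The vertex set of the geodesic path `[u, v]` of a tree. -/
def segment (u v : V) : Set V := {x | X.dist u x + X.dist x v = X.dist u v}

variable (X) in
/-- The set `S` is the vertex set of a finite path of which `v` is an endpoint. -/
def IsEndpoint (S : Set V) (v : V) : Prop := ∃ w, S = segment X v w

/-- For distinct points `u`, `v` of its axis, `g` translates in the direction from `u` to `v`. -/
def TranslatesToward (g : X ≃g X) (u v : V) : Prop :=
  X.dist u (g v) = X.dist u v + translationLength g

/-- The two automorphisms translate in the same direction along the intersection of their axes
(no condition if the axes have no common edge). -/
def SameDirection (g h : X ≃g X) : Prop :=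
  ∀ u ∈ axis g ∩ axis h, ∀ v ∈ axis g ∩ axis h, u ≠ v →
    (TranslatesToward g u v ↔ TranslatesToward h u v)

/-- The intersection of the axes is the path `[v⁻, v⁺]` of positive finite length, along which both
automorphisms translate from `v⁻` toward `v⁺`. -/
def IsOverlap (g h : X ≃g X) (vm vp : V) : Prop :=
  vm ≠ vp ∧ axis g ∩ axis h = segment X vm vp ∧
    TranslatesToward g vm vp ∧ TranslatesToward h vm vp

variable (X) in
/-- For adjacent `p`, `n`, the vertex set of the component of `X` minus the edge `{p, n}` that
contains `n`. -/
def halfTree (p n : V) : Set V := {x | X.dist x n < X.dist x p}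

/-- Schottky pairs: there are four pairwise disjoint half-trees `H₁⁺, H₁⁻, H₂⁺, H₂⁻`, cut off by
edges `e₁⁺, e₁⁻, e₂⁺, e₂⁻`, such that `gᵢ` maps `eᵢ⁻` to `eᵢ⁺` and the complement of `Hᵢ⁻`
onto `Hᵢ⁺`. Here `e = {p, n}` with `n` the endpoint inside the half-tree; index `0` of the last
argument is `-`, and index `1` is `+`. -/
def IsSchottkyPair (g₁ g₂ : X ≃g X) : Prop :=
  ∃ p n : Fin 2 → Fin 2 → V,
    (∀ i s, X.Adj (p i s) (n i s)) ∧
    (∀ i s i' s', (i, s) ≠ (i', s') →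
      Disjoint (halfTree X (p i s) (n i s)) (halfTree X (p i' s') (n i' s'))) ∧
    (∀ i, (![g₁, g₂] i) (n i 0) = p i 1 ∧ (![g₁, g₂] i) (p i 0) = n i 1 ∧
      (![g₁, g₂] i) '' (halfTree X (p i 0) (n i 0))ᶜ = halfTree X (p i 1) (n i 1))

/-- The group is free of rank two. -/
def FreeOfRankTwo (G : Type*) [Group G] : Prop := Nonempty (G ≃* FreeGroup (Fin 2))

/-- The Euclidean sequence `m₁ = a`, `m₂ = b`, `mᵢ₊₂ = mᵢ - ⌊mᵢ / mᵢ₊₁⌋ mᵢ₊₁`. The value at `0` is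
a placeholder; only the values up to the first zero are used. -/
def euclidSeq (a b : ℕ) : ℕ → ℕ
  | 0 => 0
  | 1 => a
  | 2 => b
  | i + 3 => euclidSeq a b (i + 1) -
      euclidSeq a b (i + 1) / euclidSeq a b (i + 2) * euclidSeq a b (i + 2)

/-- The partial quotients `qᵢ = ⌊mᵢ / mᵢ₊₁⌋`. -/
def euclidQuot (a b i : ℕ) : ℕ := euclidSeq a b i / euclidSeq a b (i + 1)

/-- The first index `k` with `mₖ₊₁ = 0`. -/
noncomputable def euclidLast (a b : ℕ) : ℕ := sInf {k | euclidSeq a b (k + 1) = 0}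

/-- The sequence `γᵢ₊₂ = γᵢ γᵢ₊₁^(-qᵢ)` of group elements with quotients `q` (the value at `0` is a
placeholder). -/
def elementSeq {G : Type*} [Group G] (q : ℕ → ℕ) (g₁ g₂ : G) : ℕ → G
  | 0 => 1
  | 1 => g₁
  | 2 => g₂
  | i + 3 => elementSeq q g₁ g₂ (i + 1) * elementSeq q g₁ g₂ (i + 2) ^ (-(q (i + 1) : ℤ))

/-- The window conditions on `(j, q)`, for the Euclidean data `m`, `Q`, `k` and an overlap `L`:
`(m₁ + m₂) - mⱼ + (q - 1) mⱼ₊₁ < L ≤ (m₁ + m₂) - mⱼ + q mⱼ₊₁`, `1 ≤ j ≤ k - 1`,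
`0 ≤ q ≤ Qⱼ - 1`. -/
def InWindow (m Q : ℕ → ℕ) (k L j q : ℕ) : Prop :=
  1 ≤ j ∧ j + 1 ≤ k ∧ q + 1 ≤ Q j ∧
    ((m 1 : ℤ) + m 2) - m j + ((q : ℤ) - 1) * m (j + 1) < L ∧
    (L : ℤ) ≤ ((m 1 : ℤ) + m 2) - m j + (q : ℤ) * m (j + 1)

end TreeAut

open TreeAut

namespace TreeAut

variable {V : Type*} {X : SimpleGraph V}

/-! ### The metric of a tree -/

/-! The proof rests on a quantity conserved by the Euclidean algorithm. Let `g`, `h` be hyperbolic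
with translation lengths `m > n`, translating in the same direction along a common path of length
more than `n`. At a point of this path at distance at least `n` from its lower end, `h⁻¹` moves back
by `n` along the path and `g` moves forward by `m`. So `g * h⁻¹` is hyperbolic with translation
length `m - n`, and its axis meets that of `h` exactly in the old overlap shortened by `n` at the
lower end (`AxisPair.step`). The sum of the translation lengths and the overlap both drop by `n`;
the upper end `v⁺` and the generated group do not change. Iteration (`AxisPair.euclid`) reaches the
pairs `(γ j * γ (j+1) ^ (-q), γ (j+1))`, and `windowStart` records the common drop. These thresholds
cut `(0, m₁ + m₂ - gcd]` into the windows of case (2).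

The algorithm can end in three ways. If the remaining overlap is shorter than both translation
lengths, edges of the axes cut off four disjoint half-trees, and ping-pong gives a free group
(`AxisPair.isSchottkyPair`, `IsSchottkyPair.freeOfRankTwo`). If it equals the length `n` of `h`,
then the axis of `g` and its image under `h` leave `v⁺` together, in opposite orientations, for a
length `l₀`, and `g * h⁻¹` acts on this stretch like a reflection of `a`. Either the stretch reaches
the midpoint of the reflection, which is then fixed because inversions are excluded
(`elliptic_of_return`), or `g * h⁻¹` is hyperbolic with an axis at distance `l₀` from that of `h`
(`hyperbolic_of_return`). If the overlap exceeds `m₁ + m₂ - gcd`, two elements of translation length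
`gcd` still overlap in more than `gcd`, and their quotient fixes a part of the axis
(`range_inter_fixedTree`).

Freeness fails in the presence of a nontrivial elliptic element, because discreteness and local
finiteness give it finite order. The geometry of the tree enters through medians, the four-point
condition and parametrized lines. -/

lemma dist_triangle (hX : X.IsTree) (x y z : V) : X.dist x z ≤ X.dist x y + X.dist y z :=
  hX.1.dist_triangle

lemma dist_eq_zero_iff (hX : X.IsTree) {x y : V} : X.dist x y = 0 ↔ x = y :=
  hX.1.dist_eq_zero_iff

lemma dist_apply (g : X ≃g X) (x y : V) : X.dist (g x) (g y) = X.dist x y := by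
  have key : ∀ (f : X ≃g X) (u v : V), X.Reachable u v → X.dist (f u) (f v) ≤ X.dist u v := by
    intro f u v h
    obtain ⟨p, hp⟩ := h.exists_walk_length_eq_dist
    have := SimpleGraph.dist_le (p.map f.toHom)
    rw [SimpleGraph.Walk.length_map, hp] at this
    exact this
  by_cases h : X.Reachable x y
  · refine le_antisymm (key g x y h) ?_
    have := key g.symm (g x) (g y) (h.map g.toHom)
    simpa using this
  · rw [SimpleGraph.dist_eq_zero_of_not_reachable h, SimpleGraph.dist_eq_zero_of_not_reachable]
    intro h'
    apply h
    simpa using h'.map g.symm.toHom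

/-- On a geodesic there are points at every distance from the start. -/
lemma exists_between (hX : X.IsTree) (x y : V) {i : ℕ} (hi : i ≤ X.dist x y) :
    ∃ z, X.dist x z = i ∧ X.dist z y + i = X.dist x y := by
  obtain ⟨p, hp⟩ := hX.1.exists_walk_length_eq_dist x y
  refine ⟨p.getVert i, ?_⟩
  have h1 := SimpleGraph.dist_le (p.take i)
  have h2 := SimpleGraph.dist_le (p.drop i)
  have h3 := dist_triangle hX x (p.getVert i) y
  rw [SimpleGraph.Walk.take_length] at h1
  rw [SimpleGraph.Walk.drop_length] at h2
  omega

/-- A vertex has at most one neighbour which is closer to a given vertex. -/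
lemma closer_neighbor_unique (hX : X.IsTree) {x v w w' : V} (h : X.dist w v = 1)
    (h' : X.dist w' v = 1) (hd : X.dist x w + 1 = X.dist x v)
    (hd' : X.dist x w' + 1 = X.dist x v) : w = w' := by
  rw [SimpleGraph.dist_eq_one_iff_adj] at h h'
  obtain ⟨p, hp⟩ := hX.1.exists_walk_length_eq_dist x w
  obtain ⟨p', hp'⟩ := hX.1.exists_walk_length_eq_dist x w'
  have hP : (p.concat h).IsPath := SimpleGraph.Walk.isPath_of_length_eq_dist _ (by simp; omega)
  have hP' : (p'.concat h').IsPath := SimpleGraph.Walk.isPath_of_length_eq_dist _ (by simp; omega)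
  have h2 : p.concat h = p'.concat h' :=
    congrArg Subtype.val ((hX.2.subsingleton_path x v).elim ⟨_, hP⟩ ⟨_, hP'⟩)
  exact (SimpleGraph.Walk.concat_inj h2).1

lemma dist_neighbor (hX : X.IsTree) (x : V) {v w : V} (h : X.dist v w = 1) :
    X.dist x v = X.dist x w + 1 ∨ X.dist x w = X.dist x v + 1 := by
  rw [SimpleGraph.dist_eq_one_iff_adj] at h
  exact hX.dist_eq_dist_add_one_of_adj x h

/-- Induction along the geodesic from `y` to `z`: the median for the next vertex `y'` still works
unless `y'` is farther from `x` than `y`. In that case the median for `y'` is `y'` itself, so that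
`y` lies between `x` and `z` and is the new median. -/
lemma exists_median (hX : X.IsTree) (x y z : V) :
    ∃ m, X.dist x m + X.dist m y = X.dist x y ∧ X.dist x m + X.dist m z = X.dist x z ∧
      X.dist y m + X.dist m z = X.dist y z := by
  induction hN : X.dist y z generalizing y with
  | zero =>
    have : y = z := (dist_eq_zero_iff hX).1 hN
    subst this
    exact ⟨y, by simp⟩
  | succ N ih =>
    obtain ⟨y', h1, h2⟩ := exists_between hX y z (i := 1) (by omega)
    obtain ⟨m, hm1, hm2, hm3⟩ := ih y' (by omega)
    have c1 := X.dist_comm (u := y') (v := m)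
    have c2 := X.dist_comm (u := y) (v := m)
    have t1 := dist_triangle hX y m z
    have t2 := dist_triangle hX y y' m
    rcases dist_neighbor hX x h1 with h | h
    · exact ⟨m, by omega, by omega, by omega⟩
    · by_cases hmy : m = y'
      · subst hmy
        refine ⟨y, by simp, by omega, by simp; omega⟩
      · exfalso
        have hpos : X.dist y' m ≠ 0 := fun h => hmy ((dist_eq_zero_iff hX).1 h).symm
        obtain ⟨w, hw1, hw2⟩ := exists_between hX y' m (i := 1) (by omega)
        have t3 := dist_triangle hX x m w
        have c3 := X.dist_comm (u := w) (v := m)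
        have c4 := X.dist_comm (u := w) (v := y')
        have t4 := dist_triangle hX w m z
        have hw3 : X.dist x w + 1 = X.dist x y' := by
          rcases dist_neighbor hX x hw1 with h' | h' <;> omega
        have : w = y := closer_neighbor_unique hX (by omega) h1 hw3 (by omega)
        subst this
        omega

/-- A point of a geodesic is determined by its distances from the endpoints. -/
lemma eq_of_between (hX : X.IsTree) {x y u v : V} (hu : X.dist x u + X.dist u y = X.dist x y)
    (hv : X.dist x v + X.dist v y = X.dist x y) (huv : X.dist x u = X.dist x v) : u = v := by
  induction hN : X.dist u y generalizing y with
  | zero =>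
    rw [(dist_eq_zero_iff hX).1 hN, (dist_eq_zero_iff hX).1 (show X.dist v y = 0 by omega)]
  | succ N ih =>
    obtain ⟨y₁, h1, h2⟩ := exists_between hX y u (i := 1) (by rw [X.dist_comm]; omega)
    obtain ⟨y₂, h3, h4⟩ := exists_between hX y v (i := 1) (by rw [X.dist_comm]; omega)
    have c1 := X.dist_comm (u := y) (v := y₁)
    have c2 := X.dist_comm (u := y) (v := y₂)
    have c3 := X.dist_comm (u := y) (v := u)
    have c4 := X.dist_comm (u := y) (v := v)
    have c5 := X.dist_comm (u := y₁) (v := u)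
    have c6 := X.dist_comm (u := y₂) (v := v)
    have t1 := dist_triangle hX x u y₁
    have t2 := dist_triangle hX x v y₂
    have t3 := dist_triangle hX x y₁ y
    have t4 := dist_triangle hX x y₂ y
    have : y₁ = y₂ := closer_neighbor_unique hX (x := x) (v := y) (by omega) (by omega)
      (by omega) (by omega)
    subst this
    exact ih (y := y₁) (by omega) (by omega) (by omega)

lemma dist_of_between (hX : X.IsTree) {x y u v : V} (hu : X.dist x u + X.dist u y = X.dist x y)
    (hv : X.dist x v + X.dist v y = X.dist x y) (huv : X.dist x u ≤ X.dist x v) :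
    X.dist u v + X.dist x u = X.dist x v := by
  obtain ⟨n, h1, h2⟩ := exists_between hX x v huv
  have t1 := dist_triangle hX n v y
  have t2 := dist_triangle hX x n y
  have : u = n := eq_of_between hX hu (by omega) h1.symm
  subst this
  exact h2

/-- The four-point condition. -/
lemma four_point (hX : X.IsTree) (x y z w : V) :
    X.dist x y + X.dist z w ≤ X.dist x z + X.dist y w ∨
      X.dist x y + X.dist z w ≤ X.dist x w + X.dist y z := by
  -- The medians are the projections of `z` and `w` to the geodesic from `x` to `y`; their order on
  -- it decides which alternative holds.
  obtain ⟨m, h1, h2, h3⟩ := exists_median hX z x y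
  obtain ⟨m', h1', h2', h3'⟩ := exists_median hX w x y
  have t1 := dist_triangle hX z m w
  have t2 := dist_triangle hX m m' w
  have c1 := X.dist_comm (u := m) (v := m')
  have c2 := X.dist_comm (u := x) (v := z)
  have c3 := X.dist_comm (u := x) (v := w)
  have c4 := X.dist_comm (u := y) (v := z)
  have c5 := X.dist_comm (u := y) (v := w)
  have c6 := X.dist_comm (u := x) (v := m)
  have c7 := X.dist_comm (u := x) (v := m')
  have c8 := X.dist_comm (u := w) (v := m')
  rcases le_total (X.dist x m) (X.dist x m') with h | h
  · have := dist_of_between hX h3 h3' h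
    omega
  · have := dist_of_between hX h3' h3 h
    omega

/-! ### Lines -/

variable (X) in
/-- A bi-infinite geodesic, with its parametrization. -/
def IsLine (a : ℤ → V) : Prop := ∀ i j, X.dist (a i) (a j) = (i - j).natAbs

lemma IsLine.injective {a : ℤ → V} (ha : IsLine X a) : Function.Injective a := by
  intro i j h
  have := ha i j
  rw [h, SimpleGraph.dist_self] at this
  omega

lemma IsLine.shift {a : ℤ → V} (ha : IsLine X a) (s : ℤ) : IsLine X fun i => a (i + s) := by
  intro i j
  rw [ha]
  congr 1
  ring

lemma IsLine.map {a : ℤ → V} (ha : IsLine X a) (g : X ≃g X) : IsLine X fun i => g (a i) := by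
  intro i j
  rw [dist_apply, ha]

/-- A point on the geodesic between two points of a line lies on the line. -/
lemma IsLine.eq_of_dist (hX : X.IsTree) {a : ℤ → V} (ha : IsLine X a) {i j k : ℤ} {x : V}
    (hij : i ≤ k) (hjk : k ≤ j) (h1 : (X.dist (a i) x : ℤ) = k - i)
    (h2 : (X.dist x (a j) : ℤ) = j - k) : x = a k := by
  have e1 := ha i j
  have e2 := ha i k
  have e3 := ha k j
  exact eq_of_between hX (x := a i) (y := a j) (by omega) (by omega) (by omega)

/-- Two lines which agree at two parameters agree in between. -/
lemma IsLine.eq_of_eq_of_eq (hX : X.IsTree) {a b : ℤ → V} (ha : IsLine X a) (hb : IsLine X b)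
    {i j k : ℤ} (hij : i ≤ k) (hjk : k ≤ j) (h1 : a i = b i) (h2 : a j = b j) : a k = b k := by
  have e2 := ha i k
  have e3 := ha k j
  exact hb.eq_of_dist hX hij hjk (by rw [← h1]; omega) (by rw [← h2]; omega)

/-- Every vertex has a projection to a line. -/
lemma IsLine.exists_proj (hX : X.IsTree) {a : ℤ → V} (ha : IsLine X a) (x : V) :
    ∃ k, ∀ i, X.dist x (a i) = X.dist x (a k) + (i - k).natAbs := by
  obtain ⟨k, hk⟩ : ∃ k, ∀ i, X.dist x (a k) ≤ X.dist x (a i) := by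
    have := (Set.range_nonempty fun i => X.dist x (a i))
    obtain ⟨k, hk⟩ := Nat.sInf_mem this
    exact ⟨k, fun i => by
      simp only at hk
      rw [hk]; exact Nat.sInf_le ⟨i, rfl⟩⟩
  refine ⟨k, fun i => ?_⟩
  obtain ⟨m, h1, h2, h3⟩ := exists_median hX x (a k) (a i)
  have e := ha k i
  have c := X.dist_comm (u := m) (v := a k)
  -- The median lies on the line and is no farther from `x` than `a k`, so minimality forces it to
  -- be `a k`.
  have hm : X.dist (a k) m = 0 := by
    rcases le_total k i with h | h
    · have : m = a (k + X.dist (a k) m) :=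
        ha.eq_of_dist hX (i := k) (j := i) (by omega) (by omega) (by omega) (by omega)
      have hk' := hk (k + X.dist (a k) m)
      rw [← this] at hk'
      omega
    · have c2 := X.dist_comm (u := m) (v := a i)
      have : m = a (k - X.dist (a k) m) :=
        ha.eq_of_dist hX (i := i) (j := k) (by omega) (by omega) (by omega) (by omega)
      have hk' := hk (k - X.dist (a k) m)
      rw [← this] at hk'
      omega
  rw [← (dist_eq_zero_iff hX).1 hm] at h2
  omega

/-- A sequence which is locally geodesic is a line. -/
lemma isLine_of_local (hX : X.IsTree) {a : ℤ → V} (h1 : ∀ i, X.dist (a i) (a (i + 1)) = 1)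
    (h2 : ∀ i, X.dist (a i) (a (i + 2)) = 2) : IsLine X a := by
  have key : ∀ (n : ℕ) (i : ℤ), X.dist (a i) (a (i + n)) = n ∧
      X.dist (a i) (a (i + n + 1)) = n + 1 := by
    intro n i
    induction n with
    | zero => simp [h1]
    | succ n ih =>
      obtain ⟨ih1, ih2⟩ := ih
      have e1 := h1 (i + n)
      have e2 := h1 (i + n + 1)
      have e3 := h2 (i + n)
      rw [show i + n + 1 + 1 = i + n + 2 by ring] at e2
      push_cast
      rw [show i + (n + 1 : ℤ) = i + n + 1 by ring, show i + n + 1 + 1 = i + n + 2 by ring]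
      refine ⟨ih2, ?_⟩
      -- The first alternative would read `n + 3 ≤ n + 1`; the second is the missing lower bound.
      have f := four_point hX (a i) (a (i + n + 1)) (a (i + n)) (a (i + n + 2))
      have c := X.dist_comm (u := a (i + n)) (v := a (i + n + 1))
      have t := dist_triangle hX (a i) (a (i + n + 1)) (a (i + n + 2))
      omega
  intro i j
  rcases le_total i j with h | h
  · have := (key (j - i).toNat i).1
    rw [show i + ((j - i).toNat : ℤ) = j by omega] at this
    omega
  · have := (key (i - j).toNat j).1
    rw [show j + ((i - j).toNat : ℤ) = i by omega] at this
    rw [X.dist_comm]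
    omega

/-! ### Axes of hyperbolic automorphisms -/

/-- The automorphism `g` shifts the parametrized line `a` by `t`. -/
def Shifts (g : X ≃g X) (a : ℤ → V) (t : ℤ) : Prop := ∀ i, g (a i) = a (i + t)

lemma Shifts.reparam {g : X ≃g X} {a : ℤ → V} {t : ℤ} (h : Shifts g a t) (s : ℤ) :
    Shifts g (fun i => a (i + s)) t := by
  intro i
  simp only
  rw [h, add_right_comm]

lemma Shifts.inv_apply {g : X ≃g X} {a : ℤ → V} {t : ℤ} (h : Shifts g a t) (i : ℤ) :
    g⁻¹ (a i) = a (i - t) := by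
  have := h (i - t)
  rw [sub_add_cancel] at this
  rw [← this, RelIso.inv_apply_self]

/-- A vertex `p` such that `p`, `f p`, `f (f p)` lie in this order on a geodesic lies on a line
shifted by `f`. -/
lemma exists_line (hX : X.IsTree) (f : X ≃g X) {p : V} {t : ℕ} (ht : 0 < t)
    (h1 : X.dist p (f p) = t) (h2 : X.dist p (f (f p)) = 2 * t) :
    ∃ a, IsLine X a ∧ a 0 = p ∧ Shifts f a t := by
  -- The points of the geodesic from `p` to `f (f p)`; values beyond `2 * t` are irrelevant.
  have hex : ∀ i : ℕ, ∃ z, i ≤ 2 * t → X.dist p z = i ∧ X.dist z (f (f p)) + i = 2 * t := by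
    intro i
    by_cases hi : i ≤ 2 * t
    · obtain ⟨z, hz⟩ := exists_between hX p (f (f p)) (i := i) (by omega)
      exact ⟨z, fun _ => by omega⟩
    · exact ⟨p, fun h => absurd h hi⟩
  choose c hc using hex
  have hfp : X.dist (f p) (f (f p)) = t := by rw [dist_apply, h1]
  have hct : c t = f p := by
    have := hc t (by omega)
    exact eq_of_between hX (x := p) (y := f (f p)) (by omega) (by omega) (by omega)
  have hc0 : c 0 = p := ((dist_eq_zero_iff hX).1 (hc 0 (by omega)).1).symm
  have hcd : ∀ i j : ℕ, i ≤ j → j ≤ 2 * t → X.dist (c i) (c j) + i = j := by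
    intro i j hij hj
    have e1 := hc i (by omega)
    have e2 := hc j (by omega)
    have := dist_of_between hX (x := p) (y := f (f p)) (u := c i) (v := c j) (by omega) (by omega)
      (by omega)
    omega
  -- `f` carries the first half of the geodesic to the second, as points of a geodesic are
  -- determined by their distances.
  have hfc : ∀ i : ℕ, i ≤ t → f (c i) = c (i + t) := by
    intro i hi
    have e1 := hc (i + t) (by omega)
    have e2 := hc i (by omega)
    have e3 := hcd i t hi (by omega)
    rw [hct] at e3
    have e4 : X.dist (f (c i)) (f (f p)) = t - i := by rw [dist_apply]; omega
    have e5 : X.dist (f p) (f (c i)) = i := by rw [dist_apply]; omega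
    have t1 := dist_triangle hX p (f p) (f (c i))
    have t2 := dist_triangle hX p (f (c i)) (f (f p))
    exact eq_of_between hX (x := p) (y := f (f p)) (by omega) (by omega) (by omega)
  -- The translates of the first half of the geodesic under the powers of `f`, glued together.
  set a : ℤ → V := fun i => (f ^ (i / (t : ℤ))) (c (i % (t : ℤ)).toNat) with ha
  have htz : (t : ℤ) ≠ 0 := by omega
  have haq : ∀ i q : ℤ, a (i + t * q) = (f ^ q) (a i) := by
    intro i q
    simp only [ha]
    rw [Int.add_mul_ediv_left _ _ htz, Int.add_mul_emod_self_left, add_comm, zpow_add,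
      RelIso.mul_apply]
  have haf : Shifts f a t := by
    intro i
    have := haq i 1
    rw [mul_one, zpow_one] at this
    exact this.symm
  have hac1 : ∀ i : ℕ, i < t → a i = c i := by
    intro i hi
    simp only [ha]
    rw [Int.ediv_eq_zero_of_lt (by omega) (by omega), Int.emod_eq_of_lt (by omega) (by omega)]
    simp
  have hac2 : ∀ i : ℕ, i < 2 * t → a i = c i := by
    intro i hi
    by_cases hit : i < t
    · exact hac1 i hit
    · obtain ⟨j, rfl⟩ := Nat.exists_eq_add_of_le' (not_lt.1 hit)
      rw [← hfc j (by omega), ← hac1 j (by omega), haf]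
      push_cast; rfl
  have hac : ∀ i : ℕ, i ≤ 2 * t → a i = c i := by
    intro i hi
    by_cases hit : i < 2 * t
    · exact hac2 i hit
    · obtain rfl : i = t + t := by omega
      rw [← hfc t (by omega), ← hac2 t (by omega), haf]
      push_cast; rfl
  -- A power of `f` moves `i` to its residue `r < t`, and `r + 2 ≤ 2 * t`, so the check takes place
  -- on the geodesic `c`.
  have hloc : ∀ (k : ℕ), (k = 1 ∨ k = 2) → ∀ i : ℤ, X.dist (a i) (a (i + k)) = k := by
    intro k hk i
    have hi := Int.emod_add_mul_ediv i t
    have hlt := Int.emod_lt_of_pos i (b := (t : ℤ)) (by omega)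
    have hnn := Int.emod_nonneg i htz
    rw [← hi, add_right_comm, haq, haq, dist_apply]
    obtain ⟨r, hr⟩ := Int.eq_ofNat_of_zero_le hnn
    rw [hr] at hlt ⊢
    have := hcd r (r + k) (by omega) (by omega)
    rw [← hac r (by omega), ← hac (r + k) (by omega)] at this
    push_cast at this
    omega
  refine ⟨a, isLine_of_local hX (fun i => hloc 1 (by simp) i) (fun i => hloc 2 (by simp) i), ?_,
    haf⟩
  rw [← hc0, ← hac 0 (by omega)]; rfl

/-- Let `p'` be the vertex after `p` on the geodesic from `p` to `f p`. If `f p'` is not the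
vertex before `f p` on it, then `p` lies on a line shifted by `f`. -/
lemma exists_line_of_neighbor (hX : X.IsTree) (f : X ≃g X) {p p' : V} {t : ℕ} (ht : 0 < t)
    (h1 : X.dist p (f p) = t) (h2 : X.dist p p' = 1) (h3 : X.dist p' (f p) + 1 = t)
    (h4 : X.dist p (f p') = t + 1) : ∃ a, IsLine X a ∧ a 0 = p ∧ Shifts f a t := by
  refine exists_line hX f ht h1 ?_
  have e1 : X.dist (f p) (f p') = 1 := by rw [dist_apply, h2]
  have e2 : X.dist (f p') (f (f p)) = t - 1 := by rw [dist_apply]; omega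
  have e3 : X.dist (f p) (f (f p)) = t := by rw [dist_apply, h1]
  have q := four_point hX p (f p') (f p) (f (f p))
  have c := X.dist_comm (u := f p) (v := f p')
  have tr := dist_triangle hX p (f p) (f (f p))
  omega

/-- The displacement of a vertex under an automorphism shifting a line. -/
lemma dist_apply_of_shifts (hX : X.IsTree) {g : X ≃g X} {a : ℤ → V} {t : ℤ} (ht : 0 < t)
    (ha : IsLine X a) (hg : Shifts g a t) {x : V} {k : ℤ} {D : ℕ}
    (hk : ∀ i, X.dist x (a i) = D + (i - k).natAbs) :
    (X.dist x (g x) : ℤ) = t + 2 * D := by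
  -- The projection of `g x` to the line is `a (k + t)`, again at distance `D`; two four-point
  -- inequalities then bound the displacement from both sides.
  have h1 : ∀ i, X.dist (g x) (a i) = D + (i - t - k).natAbs := by
    intro i
    have := hg (i - t)
    rw [sub_add_cancel] at this
    rw [← this, dist_apply, hk]
  have e1 := hk k
  have e2 := hk (k + t)
  have e3 := h1 k
  have e4 := h1 (k + t)
  have e5 := ha k (k + t)
  have q1 := four_point hX x (g x) (a k) (a (k + t))
  have q2 := four_point hX x (a (k + t)) (g x) (a k)
  have c1 := X.dist_comm (u := a (k + t)) (v := a k)
  have c2 := X.dist_comm (u := a (k + t)) (v := g x)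
  omega

lemma exists_dist_apply_of_shifts (hX : X.IsTree) {g : X ≃g X} {a : ℤ → V} {t : ℤ} (ht : 0 < t)
    (ha : IsLine X a) (hg : Shifts g a t) (x : V) :
    ∃ k, (X.dist x (g x) : ℤ) = t + 2 * X.dist x (a k) := by
  obtain ⟨k, hk⟩ := ha.exists_proj hX x
  exact ⟨k, dist_apply_of_shifts hX ht ha hg hk⟩

lemma dist_apply_line {g : X ≃g X} {a : ℤ → V} {t : ℤ} (ht : 0 < t)
    (ha : IsLine X a) (hg : Shifts g a t) (i : ℤ) : (X.dist (a i) (g (a i)) : ℤ) = t := by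
  rw [hg, ha]
  omega

lemma Shifts.mul {g h : X ≃g X} {a : ℤ → V} {s t : ℤ} (hg : Shifts g a s) (hh : Shifts h a t) :
    Shifts (g * h) a (t + s) := by
  intro i
  rw [RelIso.mul_apply, hh, hg, add_assoc]

/-- Displacement is `t` plus twice the distance to the line, hence never zero. An inversion is
excluded because its square would fix a vertex, whereas `g * g` also shifts the line. -/
lemma isHyperbolic_of_shifts (hX : X.IsTree) {g : X ≃g X} {a : ℤ → V} {t : ℤ} (ht : 0 < t)
    (ha : IsLine X a) (hg : Shifts g a t) : IsHyperbolic g := by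
  constructor
  · rintro ⟨v, hv⟩
    obtain ⟨k, hk⟩ := exists_dist_apply_of_shifts hX ht ha hg v
    rw [hv, SimpleGraph.dist_self] at hk
    omega
  · rintro ⟨u, v, -, h1, h2⟩
    obtain ⟨k, hk⟩ := exists_dist_apply_of_shifts hX (by omega) ha (hg.mul hg) u
    rw [RelIso.mul_apply, h1, h2, SimpleGraph.dist_self] at hk
    omega

lemma translationLength_of_shifts (hX : X.IsTree) {g : X ≃g X} {a : ℤ → V} {t : ℤ} (ht : 0 < t)
    (ha : IsLine X a) (hg : Shifts g a t) : (translationLength g : ℤ) = t := by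
  have h1 : translationLength g ≤ t.toNat := by
    refine Nat.sInf_le ⟨a 0, ?_⟩
    have := dist_apply_line ht ha hg 0
    simp only
    omega
  have h2 : t.toNat ≤ translationLength g := by
    refine le_csInf ⟨_, a 0, rfl⟩ ?_
    rintro _ ⟨x, rfl⟩
    obtain ⟨k, hk⟩ := exists_dist_apply_of_shifts hX ht ha hg x
    simp only
    omega
  omega

lemma axis_of_shifts (hX : X.IsTree) {g : X ≃g X} {a : ℤ → V} {t : ℤ} (ht : 0 < t)
    (ha : IsLine X a) (hg : Shifts g a t) : axis g = Set.range a := by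
  have e := translationLength_of_shifts hX ht ha hg
  ext x
  simp only [axis, Set.mem_ofPred_eq, Set.mem_range]
  constructor
  · intro h
    obtain ⟨k, hk⟩ := exists_dist_apply_of_shifts hX ht ha hg x
    exact ⟨k, ((dist_eq_zero_iff hX).1 (by omega)).symm⟩
  · rintro ⟨i, rfl⟩
    have := dist_apply_line ht ha hg i
    omega

/-- A hyperbolic automorphism shifts a line. -/
lemma IsHyperbolic.exists_line (hX : X.IsTree) {g : X ≃g X} (hg : IsHyperbolic g) :
    ∃ a, IsLine X a ∧ Shifts g a (translationLength g) ∧ 0 < translationLength g := by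
  have : Nonempty V := hX.1.nonempty
  obtain ⟨p, hp⟩ : translationLength g ∈ Set.range fun v => X.dist v (g v) :=
    Nat.sInf_mem (Set.range_nonempty _)
  simp only at hp
  have hmin : ∀ v, translationLength g ≤ X.dist v (g v) := fun v => Nat.sInf_le ⟨v, rfl⟩
  set t := translationLength g with ht
  have hpos : 0 < t := by
    by_contra h
    exact hg.1 ⟨p, ((dist_eq_zero_iff hX).1 (by omega)).symm⟩
  obtain ⟨p', h1, h2⟩ := exists_between hX p (g p) (i := 1) (by omega)
  have e1 : X.dist (g p) (g p') = 1 := by rw [dist_apply, h1]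
  suffices h : X.dist p (g p') = t + 1 by
    obtain ⟨a, ha, -, hs⟩ := exists_line_of_neighbor hX g hpos hp h1 (by omega) h
    exact ⟨a, ha, hs, hpos⟩
  -- If `g p'` were on the way back to `p`, then `p'` would be displaced by `t - 2` only, or, for `t
  -- = 1`, the edge from `p` to `p'` would be inverted.
  rcases dist_neighbor hX p e1 with h | h
  · exfalso
    rw [hp] at h
    have c := X.dist_comm (u := g p) (v := g p')
    have tr := dist_triangle hX p p' (g p')
    have hm := hmin p'
    rcases Nat.lt_or_ge 1 t with ht1 | ht1
    · -- `g p'` is the vertex before `g p` on the geodesic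
      obtain ⟨w, hw1, hw2⟩ := exists_between hX p' (g p) (i := t - 2) (by omega)
      have t2 := dist_triangle hX p p' w
      have t3 := dist_triangle hX p w (g p)
      have : w = g p' := closer_neighbor_unique hX (x := p) (v := g p) (by omega) (by omega)
        (by omega) (by omega)
      subst this
      omega
    · have hpp : p' = g p := (dist_eq_zero_iff hX).1 (by omega)
      have hpp' : p = g p' := (dist_eq_zero_iff hX).1 (by omega)
      exact hg.2 ⟨p, p', SimpleGraph.dist_eq_one_iff_adj.1 h1, hpp.symm, hpp'.symm⟩
  · omega

/-! ### Lengths of paths -/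

lemma pathLength_image {a : ℤ → V} (ha : IsLine X a) (I : Set ℤ) :
    pathLength X (a '' I) = {i | i ∈ I ∧ i + 1 ∈ I}.encard := by
  have hadj : ∀ i j, X.Adj (a i) (a j) ↔ (i - j).natAbs = 1 := by
    intro i j
    rw [← SimpleGraph.dist_eq_one_iff_adj, ha]
  have : {e ∈ X.edgeSet | ∀ v ∈ e, v ∈ a '' I} =
      (fun i => s(a i, a (i + 1))) '' {i | i ∈ I ∧ i + 1 ∈ I} := by
    ext e
    induction e using Sym2.ind with
    | _ u v =>
      simp only [SimpleGraph.mem_edgeSet, Sym2.mem_iff, Set.mem_image,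
        Set.mem_ofPred_eq, forall_eq_or_imp, forall_eq]
      constructor
      · rintro ⟨huv, ⟨i, hi, rfl⟩, ⟨j, hj, rfl⟩⟩
        have := (hadj i j).1 huv
        rcases le_total i j with h | h
        · obtain rfl : j = i + 1 := by omega
          exact ⟨i, ⟨hi, hj⟩, rfl⟩
        · obtain rfl : i = j + 1 := by omega
          exact ⟨j, ⟨hj, hi⟩, Sym2.eq_swap⟩
      · rintro ⟨i, ⟨hi, hi'⟩, h⟩
        have hi1 : X.Adj (a i) (a (i + 1)) := (hadj _ _).2 (by omega)
        rw [Sym2.eq_iff] at h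
        rcases h with ⟨rfl, rfl⟩ | ⟨rfl, rfl⟩
        · exact ⟨hi1, ⟨i, hi, rfl⟩, ⟨_, hi', rfl⟩⟩
        · exact ⟨hi1.symm, ⟨_, hi', rfl⟩, ⟨i, hi, rfl⟩⟩
  rw [pathLength, this, Set.InjOn.encard_image]
  intro i _ j _ h
  simp only [Sym2.eq_iff] at h
  rcases h with ⟨h, -⟩ | ⟨h1, h2⟩
  · exact ha.injective h
  · have := ha.injective h1
    have := ha.injective h2
    omega

lemma pathLength_image_Icc {a : ℤ → V} (ha : IsLine X a) (s e : ℤ) :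
    pathLength X (a '' Set.Icc s e) = ((e - s).toNat : ℕ∞) := by
  rw [pathLength_image ha]
  have : {i | i ∈ Set.Icc s e ∧ i + 1 ∈ Set.Icc s e} = Set.Ico s e := by
    ext i
    simp only [Set.mem_ofPred_eq, Set.mem_Icc, Set.mem_Ico]
    omega
  rw [this, ← Finset.coe_Ico, Set.encard_coe_eq_coe_finsetCard, Int.card_Ico]

lemma pathLength_mono {S T : Set V} (h : S ⊆ T) : pathLength X S ≤ pathLength X T :=
  Set.encard_le_encard fun _ he => ⟨he.1, fun v hv => h (he.2 v hv)⟩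

lemma pathLength_image_eq_top {a : ℤ → V} (ha : IsLine X a) {I : Set ℤ} (hI : I.OrdConnected)
    (h : ∀ r : ℕ, ∃ i ∈ I, i + r ∈ I) : pathLength X (a '' I) = ⊤ := by
  rw [ENat.eq_top_iff_forall_ge]
  intro r
  obtain ⟨i, hi, hi'⟩ := h r
  refine le_trans ?_ (pathLength_mono (Set.image_mono (hI.out hi hi')))
  rw [pathLength_image_Icc ha]
  simp

/-- This dichotomy separates finite overlaps from overlaps that are rays or lines. -/
lemma ordConnected_int {I : Set ℤ} (hI : I.OrdConnected) (hne : I.Nonempty) :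
    (∃ s e, s ≤ e ∧ I = Set.Icc s e) ∨ ∀ r : ℕ, ∃ i ∈ I, i + r ∈ I := by
  by_cases h : BddAbove I ∧ BddBelow I
  · left
    obtain ⟨s, hs⟩ := Int.exists_least_of_bdd (P := (· ∈ I))
      (by obtain ⟨b, hb⟩ := h.2; exact ⟨b, fun z hz => hb hz⟩) hne
    obtain ⟨e, he⟩ := Int.exists_greatest_of_bdd (P := (· ∈ I))
      (by obtain ⟨b, hb⟩ := h.1; exact ⟨b, fun z hz => hb hz⟩) hne
    refine ⟨s, e, hs.2 e he.1, Set.Subset.antisymm (fun i hi => ⟨hs.2 i hi, he.2 i hi⟩)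
      (hI.out hs.1 he.1)⟩
  · right
    intro r
    obtain ⟨j, hj⟩ := hne
    rw [not_and_or] at h
    rcases h with h | h
    · rw [not_bddAbove_iff] at h
      obtain ⟨y, hy, hy'⟩ := h (j + r)
      exact ⟨j, hj, hI.out hj hy ⟨by omega, by omega⟩⟩
    · rw [not_bddBelow_iff] at h
      obtain ⟨y, hy, hy'⟩ := h (j - r)
      exact ⟨j - r, hI.out hy hj ⟨by omega, by omega⟩, by simpa using hj⟩

lemma natCast_le_pathLength_image {a : ℤ → V} (ha : IsLine X a) {I : Set ℤ}
    (hI : I.OrdConnected) (hne : I.Nonempty) (r : ℕ) :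
    (r : ℕ∞) ≤ pathLength X (a '' I) ↔ ∃ i ∈ I, i + r ∈ I := by
  constructor
  · rcases ordConnected_int hI hne with ⟨s, e, hse, rfl⟩ | h
    · intro h
      rw [pathLength_image_Icc ha, Nat.cast_le] at h
      exact ⟨s, ⟨by omega, by omega⟩, ⟨by omega, by omega⟩⟩
    · exact fun _ => h r
  · rintro ⟨i, hi, hi'⟩
    refine le_trans ?_ (pathLength_mono (Set.image_mono (hI.out hi hi')))
    rw [pathLength_image_Icc ha]
    simp

lemma pathLength_eq_zero_iff {S : Set V} :
    pathLength X S = 0 ↔ ∀ u ∈ S, ∀ v ∈ S, X.dist u v ≠ 1 := by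
  rw [pathLength, Set.encard_eq_zero, Set.eq_empty_iff_forall_notMem]
  constructor
  · intro h u hu v hv huv
    refine h s(u, v) ⟨SimpleGraph.dist_eq_one_iff_adj.1 huv, ?_⟩
    simp [hu, hv]
  · rintro h e ⟨he, hS⟩
    induction e using Sym2.ind with
    | _ u v =>
      exact h u (hS u (by simp)) v (hS v (by simp)) (SimpleGraph.dist_eq_one_iff_adj.2 he)

/-- A geodesic continues to be one after a turn away from its start. -/
lemma dist_add_of_turn (hX : X.IsTree) {x y z v : V} (hv : X.dist x v = 1)
    (hvz : X.dist v z + 1 = X.dist x z) (hy : X.dist y v = X.dist y x + 1) :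
    X.dist y z = X.dist y x + X.dist x z := by
  obtain ⟨m, h1, h2, h3⟩ := exists_median hX x y z
  have c := X.dist_comm (u := x) (v := y)
  have c2 := X.dist_comm (u := m) (v := y)
  by_cases hm : X.dist x m = 0
  · omega
  -- Otherwise the first step from `x` toward the median is `v`, and it would lead toward `y` as
  -- well.
  · obtain ⟨w, hw1, hw2⟩ := exists_between hX x m (i := 1) (by omega)
    have t1 := dist_triangle hX w m z
    have t2 := dist_triangle hX w m y
    have t3 := dist_triangle hX x w z
    have : w = v := eq_of_between hX (x := x) (y := z) (by omega) (by omega) (by omega)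
    subst this
    have c3 := X.dist_comm (u := w) (v := y)
    omega

lemma dist_neighbor_of_ne (hX : X.IsTree) {x y u v : V} (hu : X.dist u x = 1)
    (hv : X.dist v x = 1) (huy : X.dist y u + 1 = X.dist y x) (h : u ≠ v) :
    X.dist y v = X.dist y x + 1 := by
  rcases dist_neighbor hX y hv with h' | h'
  · exact h'
  · exact absurd (closer_neighbor_unique hX hu hv huy h'.symm) h

/-! ### Pairs of hyperbolic automorphisms with overlapping axes -/

/-- The automorphisms `g` and `h` shift the lines `a` and `b` by `m > 0` and `n > 0`, and `I` is
the set of parameters at which the two lines agree. -/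
structure AxisPair (g h : X ≃g X) (m n : ℤ) (a b : ℤ → V) (I : Set ℤ) : Prop where
  left_line : IsLine X a
  right_line : IsLine X b
  left_shifts : Shifts g a m
  right_shifts : Shifts h b n
  left_pos : 0 < m
  right_pos : 0 < n
  mem_iff : ∀ i, i ∈ I ↔ a i = b i

namespace AxisPair

variable {g h : X ≃g X} {m n : ℤ} {a b : ℤ → V} {I : Set ℤ}

lemma symm (P : AxisPair g h m n a b I) : AxisPair h g n m b a I :=
  ⟨P.2, P.1, P.4, P.3, P.6, P.5, fun i => (P.7 i).trans eq_comm⟩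

lemma ordConnected (hX : X.IsTree) (P : AxisPair g h m n a b I) : I.OrdConnected := by
  constructor
  intro i hi j hj k hk
  rw [P.mem_iff] at *
  exact P.left_line.eq_of_eq_of_eq hX P.right_line hk.1 hk.2 hi hj

/-- Two consecutive parameters of agreement fix both position and orientation: comparing distances
to them shows that `a i = b j` forces `i = j`. -/
lemma range_inter_range (P : AxisPair g h m n a b I) {i₀ : ℤ} (h0 : i₀ ∈ I) (h1 : i₀ + 1 ∈ I) :
    Set.range a ∩ Set.range b = a '' I := by
  ext x
  constructor
  · rintro ⟨⟨i, rfl⟩, ⟨j, hj⟩⟩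
    refine ⟨i, ?_, rfl⟩
    rw [P.mem_iff] at *
    have e1 := P.left_line i i₀
    have e2 := P.left_line i (i₀ + 1)
    have e3 := P.right_line j i₀
    have e4 := P.right_line j (i₀ + 1)
    rw [← h0, hj] at e3
    rw [← h1, hj] at e4
    obtain rfl : i = j := by omega
    exact hj.symm
  · rintro ⟨i, hi, rfl⟩
    exact ⟨⟨i, rfl⟩, i, ((P.mem_iff i).1 hi).symm⟩

lemma mul_inv_apply (P : AxisPair g h m n a b I) {i : ℤ} (hi : i ∈ I) (hi' : i - n ∈ I) :
    (g * h⁻¹) (a i) = a (i - n + m) := by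
  rw [RelIso.mul_apply, (P.mem_iff i).1 hi, P.right_shifts.inv_apply, ← (P.mem_iff _).1 hi',
    P.left_shifts]

lemma mul_inv_apply_right (P : AxisPair g h m n a b I) (i : ℤ) :
    (g * h⁻¹) (b i) = g (b (i - n)) := by
  rw [RelIso.mul_apply, P.right_shifts.inv_apply]

/-- The subtractive step of the Euclidean algorithm. -/
lemma step (hX : X.IsTree) (P : AxisPair g h m n a b I) (hmn : n < m) {i₀ : ℤ} (h0 : i₀ ∈ I)
    (h1 : i₀ + 1 ∈ I) (hn : i₀ - n ∈ I) :
    ∃ c, AxisPair (g * h⁻¹) h (m - n) n c b {i | i ∈ I ∧ i - n ∈ I} := by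
  have hI := P.ordConnected hX
  have hnpos := P.right_pos
  obtain ⟨t, ht⟩ : ∃ t : ℕ, m - n = t := ⟨(m - n).toNat, by omega⟩
  set f := g * h⁻¹ with hf
  have hfa : ∀ i, i ∈ I → i - n ∈ I → f (a i) = a (i + t) := by
    intro i hi hi'
    rw [hf, P.mul_inv_apply hi hi', ← ht]
    congr 1
    ring
  have hfb := P.mul_inv_apply_right
  have hn1 : i₀ + 1 - n ∈ I := hI.out hn h0 ⟨by omega, by omega⟩
  have d1 := P.left_line i₀ (i₀ + t)
  have d2 := P.left_line i₀ (i₀ + 1)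
  have d3 := P.left_line (i₀ + 1) (i₀ + t)
  have d4 := P.left_line i₀ (i₀ + 1 + t)
  rw [← hfa _ h0 hn] at d1 d3
  rw [← hfa _ h1 hn1] at d4
  -- Since `f` moves both `a i₀` and `a (i₀ + 1)` forward by `t` along `a`, there is no backtracking
  -- at `a i₀`.
  obtain ⟨c₀, hc₀, hc00, hc₀f⟩ := exists_line_of_neighbor hX f (p := a i₀) (p' := a (i₀ + 1))
    (t := t) (by omega) (by omega) (by omega) (by omega) (by omega)
  obtain ⟨c, hc, hcf, hci⟩ : ∃ c, IsLine X c ∧ Shifts f c t ∧ c i₀ = a i₀ :=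
    ⟨_, hc₀.shift (-i₀), hc₀f.reparam (-i₀), by simpa using hc00⟩
  have hci' : c (i₀ + t) = a (i₀ + t) := by rw [← hcf, hci, hfa _ h0 hn]
  have hbetween : ∀ {i j k : ℤ}, i ≤ k → k ≤ j → c i = a i → c j = a j → c k = a k :=
    fun h1 h2 => hc.eq_of_eq_of_eq hX P.left_line h1 h2
  -- Agreement of `c` with `a` holds on the first `t` steps by convexity and spreads by applying
  -- `f`, upward here and downward next.
  have hup : ∀ k : ℕ, i₀ + k ∈ I → c (i₀ + k) = a (i₀ + k) := by
    intro k
    induction k using Nat.strong_induction_on with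
    | _ k ih =>
      intro hk
      by_cases hkt : k ≤ t
      · exact hbetween (by omega) (by omega) hci hci'
      · have e : i₀ + ((k - t : ℕ) : ℤ) + t = i₀ + k := by omega
        have hm1 : i₀ + ((k - t : ℕ) : ℤ) ∈ I := hI.out h0 hk ⟨by omega, by omega⟩
        have hm2 : i₀ + ((k - t : ℕ) : ℤ) - n ∈ I := hI.out hn hk ⟨by omega, by omega⟩
        rw [← e, ← hcf, ih (k - t) (by omega) hm1, hfa _ hm1 hm2]
  have hdown : ∀ k : ℕ, i₀ - k ∈ I → i₀ - k - n ∈ I → c (i₀ - k) = a (i₀ - k) := by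
    intro k
    induction k using Nat.strong_induction_on with
    | _ k ih =>
      intro hk hk'
      apply f.injective
      rw [hcf, hfa _ hk hk']
      by_cases hkt : k ≤ t
      · exact hbetween (i := i₀) (j := i₀ + t) (by omega) (by omega) hci hci'
      · have e : i₀ - k + t = i₀ - ((k - t : ℕ) : ℤ) := by omega
        rw [e]
        exact ih (k - t) (by omega) (hI.out hk h0 ⟨by omega, by omega⟩)
          (hI.out hk' hn ⟨by omega, by omega⟩)
  have hcI : ∀ i, i ∈ I → i - n ∈ I → c i = a i := by
    intro i hi hi'
    rcases le_total i₀ i with h | h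
    · have := hup (i - i₀).toNat
      rw [show i₀ + ((i - i₀).toNat : ℤ) = i by omega] at this
      exact this hi
    · have := hdown (i₀ - i).toNat
      rw [show i₀ - ((i₀ - i).toNat : ℤ) = i by omega] at this
      exact this hi hi'
  have hcb0 : c i₀ = b i₀ := by rw [hci, ← P.mem_iff]; exact h0
  -- Conversely, `c` follows `a` for `t` steps beyond each point of the new overlap, so a further
  -- common point of `c` and `b` also lies on `a`.
  have hup' : ∀ k : ℕ, c (i₀ + k) = b (i₀ + k) → i₀ + k ∈ I ∧ i₀ + k - n ∈ I := by
    intro k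
    induction k with
    | zero => intro _; simpa using ⟨h0, hn⟩
    | succ k ih =>
      intro hk
      push_cast at hk ⊢
      obtain ⟨ih1, ih2⟩ := ih (hc.eq_of_eq_of_eq hX P.right_line (by omega) (by omega) hcb0 hk)
      have e1 := hcI _ ih1 ih2
      have e2 : c (i₀ + k + t) = a (i₀ + k + t) := by rw [← hcf, e1, hfa _ ih1 ih2]
      have e3 : c (i₀ + (k + 1)) = a (i₀ + (k + 1)) :=
        hbetween (by omega) (by omega) e1 e2
      have hm1 : i₀ + (k + 1 : ℤ) ∈ I := by rw [P.mem_iff, ← e3, hk]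
      exact ⟨hm1, hI.out hn hm1 ⟨by omega, by omega⟩⟩
  have hdown' : ∀ k : ℕ, c (i₀ - k) = b (i₀ - k) → i₀ - k ∈ I ∧ i₀ - k - n ∈ I := by
    intro k
    induction k with
    | zero => intro _; simpa using ⟨h0, hn⟩
    | succ k ih =>
      intro hk
      push_cast at hk ⊢
      obtain ⟨ih1, ih2⟩ := ih (hc.eq_of_eq_of_eq hX P.right_line (by omega) (by omega) hk hcb0)
      have hm1 : i₀ - (k + 1 : ℤ) ∈ I := hI.out ih2 h0 ⟨by omega, by omega⟩
      refine ⟨hm1, ?_⟩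
      have e1 : c (i₀ - (k + 1) + t) = a (i₀ - (k + 1) + t) :=
        hbetween (i := i₀ - k) (j := i₀ + t) (by omega) (by omega) (hcI _ ih1 ih2) hci'
      -- Both sides are the image under `f` of the common point of `c` and `b`; cancelling `g`
      -- detects membership of the index reduced by `n`.
      have e2 : g (b (i₀ - (k + 1) - n)) = g (a (i₀ - (k + 1) - n)) := by
        rw [← hfb, ← hf, ← hk, hcf, e1, P.left_shifts]
        congr 1
        omega
      rw [P.mem_iff]
      exact (g.injective e2).symm
  refine ⟨c, hc, P.right_line, by rw [ht]; exact hcf, P.right_shifts, by omega, hnpos, ?_⟩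
  intro i
  constructor
  · rintro ⟨hi, hi'⟩
    rw [hcI i hi hi', ← P.mem_iff]
    exact hi
  · intro hi
    rcases le_total i₀ i with h | h
    · have := hup' (i - i₀).toNat
      rw [show i₀ + ((i - i₀).toNat : ℤ) = i by omega] at this
      exact this hi
    · have := hdown' (i₀ - i).toNat
      rw [show i₀ - ((i₀ - i).toNat : ℤ) = i by omega] at this
      exact this hi

/-- The last step of the Euclidean algorithm: for equal translation lengths and a long overlap,
`g * h⁻¹` fixes a part of the axis of `h`. -/
lemma range_inter_fixedTree (hX : X.IsTree) (P : AxisPair g h n n a b I) {i₀ : ℤ} (h0 : i₀ ∈ I)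
    (hn : i₀ - n ∈ I) :
    Set.range b ∩ fixedTree (g * h⁻¹) = b '' {i | i ∈ I ∧ i - n ∈ I} := by
  have hI := P.ordConnected hX
  have hnpos := P.right_pos
  set f := g * h⁻¹ with hf
  have hfI : ∀ i, i ∈ I → i - n ∈ I → f (b i) = b i := by
    intro i hi hi'
    rw [← (P.mem_iff i).1 hi, hf, P.mul_inv_apply hi hi', sub_add_cancel]
  have hfb := P.mul_inv_apply_right
  have hline := P.right_line.map f
  have hbetween : ∀ {i j k : ℤ}, i ≤ k → k ≤ j → f (b i) = b i → f (b j) = b j → f (b k) = b k :=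
    fun h1 h2 => hline.eq_of_eq_of_eq hX P.right_line h1 h2
  have hf0 := hfI _ h0 hn
  have hup : ∀ k : ℕ, f (b (i₀ + k)) = b (i₀ + k) → i₀ + k ∈ I ∧ i₀ + k - n ∈ I := by
    intro k
    induction k with
    | zero => intro _; simpa using ⟨h0, hn⟩
    | succ k ih =>
      intro hk
      push_cast at hk ⊢
      obtain ⟨ih1, ih2⟩ := ih (hbetween (by omega) (by omega) hf0 hk)
      have hm : i₀ + (k + 1 : ℤ) - n ∈ I := hI.out hn ih1 ⟨by omega, by omega⟩
      refine ⟨?_, hm⟩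
      rw [P.mem_iff, ← hk, hf, hfb, ← (P.mem_iff _).1 hm, P.left_shifts, sub_add_cancel]
  have hdown : ∀ k : ℕ, f (b (i₀ - k)) = b (i₀ - k) → i₀ - k ∈ I ∧ i₀ - k - n ∈ I := by
    intro k
    induction k with
    | zero => intro _; simpa using ⟨h0, hn⟩
    | succ k ih =>
      intro hk
      push_cast at hk ⊢
      obtain ⟨ih1, ih2⟩ := ih (hbetween (by omega) (by omega) hk hf0)
      have hm : i₀ - (k + 1 : ℤ) ∈ I := hI.out ih2 h0 ⟨by omega, by omega⟩
      refine ⟨hm, ?_⟩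
      rw [P.mem_iff]
      apply g.injective
      rw [← hfb, ← hf, hk, P.left_shifts, sub_add_cancel, (P.mem_iff _).1 hm]
  ext x
  constructor
  · rintro ⟨⟨i, rfl⟩, hi⟩
    refine ⟨i, ?_, rfl⟩
    change f (b i) = b i at hi
    rcases le_total i₀ i with h | h
    · have := hup (i - i₀).toNat
      rw [show i₀ + ((i - i₀).toNat : ℤ) = i by omega] at this
      exact this hi
    · have := hdown (i₀ - i).toNat
      rw [show i₀ - ((i₀ - i).toNat : ℤ) = i by omega] at this
      exact this hi
  · rintro ⟨i, ⟨hi, hi'⟩, rfl⟩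
    exact ⟨⟨i, rfl⟩, hfI i hi hi'⟩

end AxisPair

/-- Two hyperbolic automorphisms whose axes have a common edge, and which translate in the same
direction along the intersection, form an axis pair. -/
lemma exists_axisPair (hX : X.IsTree) {g h : X ≃g X} (hg : IsHyperbolic g) (hh : IsHyperbolic h)
    (hdir : SameDirection g h) (hl : pathLength X (axis g ∩ axis h) ≠ 0) :
    ∃ a b I, AxisPair g h (translationLength g) (translationLength h) a b I ∧
      ∃ i₀, i₀ ∈ I ∧ i₀ + 1 ∈ I := by
  obtain ⟨a, ha, hga, hgp⟩ := hg.exists_line hX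
  obtain ⟨b, hb, hhb, hhp⟩ := hh.exists_line hX
  have hag := axis_of_shifts hX (by omega) ha hga
  have hah := axis_of_shifts hX (by omega) hb hhb
  rw [Ne, pathLength_eq_zero_iff] at hl
  push Not at hl
  obtain ⟨u, hu, v, hv, huv⟩ := hl
  have key : ∃ i, a i ∈ axis h ∧ a (i + 1) ∈ axis h := by
    obtain ⟨i, rfl⟩ : u ∈ Set.range a := hag ▸ hu.1
    obtain ⟨j, rfl⟩ : v ∈ Set.range a := hag ▸ hv.1
    rw [ha] at huv
    rcases le_total i j with h | h
    · obtain rfl : j = i + 1 := by omega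
      exact ⟨i, hu.2, hv.2⟩
    · obtain rfl : i = j + 1 := by omega
      exact ⟨j, hv.2, hu.2⟩
  obtain ⟨i, hi, hi'⟩ := key
  have hig : ∀ k, a k ∈ axis g := fun k => by rw [hag]; exact ⟨k, rfl⟩
  have d := ha i (i + 1)
  have hTg : TranslatesToward g (a i) (a (i + 1)) := by
    rw [TranslatesToward, hga, ha, ha]
    omega
  have hTh := (hdir _ ⟨hig i, hi⟩ _ ⟨hig (i + 1), hi'⟩ (fun h => by
    have := ha.injective h; omega)).1 hTg
  rw [hah] at hi hi'
  obtain ⟨j, hj⟩ := hi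
  obtain ⟨j', hj'⟩ := hi'
  rw [TranslatesToward, ← hj, ← hj', hhb, hb, hb] at hTh
  rw [← hj, ← hj', hb] at d
  -- The common direction of translation rules out `j' = j - 1`, so a shift of the parameter of `b`
  -- makes the lines agree on this edge.
  obtain rfl : j' = j + 1 := by omega
  refine ⟨a, fun k => b (k + (j - i)), {k | a k = b (k + (j - i))},
    ⟨ha, hb.shift _, hga, hhb.reparam _, by omega, by omega, fun k => Iff.rfl⟩, i, ?_, ?_⟩
  · change a i = b (i + (j - i))
    rw [← hj]; congr 1; ring
  · change a (i + 1) = b (i + 1 + (j - i))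
    rw [← hj']; congr 1; ring

/-! ### Distances between points on two lines -/

/-- Two rays that start at `a i₀ = b j₀` in different directions form a line. -/
lemma dist_of_diverging (hX : X.IsTree) {a b : ℤ → V} (ha : IsLine X a) (hb : IsLine X b)
    {i₀ j₀ i j ε δ : ℤ} (h0 : a i₀ = b j₀) (hε : ε = 1 ∨ ε = -1) (hδ : δ = 1 ∨ δ = -1)
    (hne : a (i₀ + ε) ≠ b (j₀ + δ)) (hi : i = i₀ ∨ 0 < (i - i₀) * ε)
    (hj : j = j₀ ∨ 0 < (j - j₀) * δ) :
    X.dist (a i) (b j) = (i - i₀).natAbs + (j - j₀).natAbs := by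
  have e1 := ha i i₀
  have e2 := hb j₀ j
  rcases hi with rfl | hi
  · rw [h0, e2]; omega
  rcases hj with rfl | hj
  · rw [← h0, e1]; omega
  have e3 := ha (i₀ + ε) i₀
  have e4 := hb (j₀ + δ) j₀
  have e5 := ha i (i₀ + ε)
  have e6 := hb (j₀ + δ) j
  have e7 := hb j₀ (j₀ + δ)
  rw [h0] at e1 e3
  have hturn : X.dist (a i) (b (j₀ + δ)) = X.dist (a i) (b j₀) + 1 := by
    refine dist_neighbor_of_ne hX (u := a (i₀ + ε)) ?_ ?_ ?_ hne
    · rcases hε with rfl | rfl <;> omega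
    · rcases hδ with rfl | rfl <;> omega
    · rcases hε with rfl | rfl <;> omega
  rw [dist_add_of_turn hX (v := b (j₀ + δ)) ?_ ?_ hturn]
  · omega
  · rcases hδ with rfl | rfl <;> omega
  · rcases hδ with rfl | rfl <;> omega

namespace AxisPair

variable {g h : X ≃g X} {m n : ℤ} {a b : ℤ → V} {s e : ℤ}

/-- The lines part at both ends of the overlap, so geodesics between their outer portions run
through `a e` or `a s`. With the two lemmas that follow, this gives the distances needed later. -/
lemma dist_right_right (hX : X.IsTree) (P : AxisPair g h m n a b (Set.Icc s e)) (hse : s ≤ e)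
    {i j : ℤ} (hi : e ≤ i) (hj : e ≤ j) : (X.dist (a i) (b j) : ℤ) = (i - e) + (j - e) := by
  have h1 : a (e + 1) ≠ b (e + 1) := fun h => by
    have := (P.mem_iff _).2 h; simp at this
  have h0 := (P.mem_iff e).1 ⟨hse, le_rfl⟩
  have := dist_of_diverging hX P.left_line P.right_line (i := i) (j := j) h0 (Or.inl rfl)
    (Or.inl rfl) h1 (by omega) (by omega)
  omega

lemma dist_left_left (hX : X.IsTree) (P : AxisPair g h m n a b (Set.Icc s e)) (hse : s ≤ e)
    {i j : ℤ} (hi : i ≤ s) (hj : j ≤ s) : (X.dist (a i) (b j) : ℤ) = (s - i) + (s - j) := by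
  have h1 : a (s + -1) ≠ b (s + -1) := fun h => by
    have := (P.mem_iff _).2 h; simp at this
  have h0 := (P.mem_iff s).1 ⟨le_rfl, hse⟩
  have := dist_of_diverging hX P.left_line P.right_line (i := i) (j := j) h0 (Or.inr rfl)
    (Or.inr rfl) h1 (by omega) (by omega)
  omega

lemma dist_right_left (hX : X.IsTree) (P : AxisPair g h m n a b (Set.Icc s e)) (hse : s < e)
    {i j : ℤ} (hi : e ≤ i) (hj : j ≤ e) : (X.dist (a i) (b j) : ℤ) = i - j := by
  have h0 := (P.mem_iff e).1 ⟨hse.le, le_rfl⟩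
  have h2 := (P.mem_iff (e + -1)).1 ⟨by omega, by omega⟩
  have h1 : a (e + 1) ≠ b (e + -1) := fun h => by
    have := P.left_line.injective (h.trans h2.symm); omega
  have := dist_of_diverging hX P.left_line P.right_line (i := i) (j := j) h0 (Or.inl rfl)
    (Or.inr rfl) h1 (by omega) (by omega)
  omega

end AxisPair

/-- If two lines have no common edge, then the distances between their points are given by the
distance of the lines and a pair of closest points. -/
lemma exists_bridge (hX : X.IsTree) {a b : ℤ → V} (ha : IsLine X a) (hb : IsLine X b)
    (h : pathLength X (Set.range a ∩ Set.range b) = 0) :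
    ∃ (i₀ j₀ : ℤ) (D : ℕ), ∀ i j,
      X.dist (a i) (b j) = D + (i - i₀).natAbs + (j - j₀).natAbs := by
  obtain ⟨⟨i₀, j₀⟩, hmin⟩ : ∃ p : ℤ × ℤ, ∀ i j, X.dist (a p.1) (b p.2) ≤ X.dist (a i) (b j) := by
    obtain ⟨p, hp⟩ := Nat.sInf_mem
      (Set.range_nonempty fun p : ℤ × ℤ => X.dist (a p.1) (b p.2))
    exact ⟨p, fun i j => by
      simp only at hp
      rw [hp]; exact Nat.sInf_le ⟨(i, j), rfl⟩⟩
  simp only at hmin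
  refine ⟨i₀, j₀, X.dist (a i₀) (b j₀), fun i j => ?_⟩
  have h1 : ∀ i, X.dist (b j₀) (a i) = X.dist (a i₀) (b j₀) + (i - i₀).natAbs := by
    obtain ⟨k, hk⟩ := ha.exists_proj hX (b j₀)
    have e1 := hk i₀
    have e2 := hmin k j₀
    have c1 := X.dist_comm (u := b j₀) (v := a i₀)
    have c2 := X.dist_comm (u := b j₀) (v := a k)
    obtain rfl : k = i₀ := by omega
    intro i
    rw [hk, X.dist_comm]
  have h2 : ∀ j, X.dist (a i₀) (b j) = X.dist (a i₀) (b j₀) + (j - j₀).natAbs := by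
    obtain ⟨k, hk⟩ := hb.exists_proj hX (a i₀)
    have e1 := hk j₀
    have e2 := hmin i₀ k
    obtain rfl : k = j₀ := by omega
    exact hk
  have e1 := h1 i
  have e2 := h2 j
  have e3 := ha i₀ i
  have e4 := hb j₀ j
  by_cases hD : X.dist (a i₀) (b j₀) = 0
  -- Lines that cross in one vertex: without a common edge, all four pairs of directions diverge.
  · have h0 : a i₀ = b j₀ := (dist_eq_zero_iff hX).1 hD
    have hne : ∀ ε δ : ℤ, (ε = 1 ∨ ε = -1) → (δ = 1 ∨ δ = -1) → a (i₀ + ε) ≠ b (j₀ + δ) := by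
      intro ε δ hε hδ heq
      refine pathLength_eq_zero_iff.1 h (a i₀) ⟨⟨_, rfl⟩, _, h0.symm⟩ (a (i₀ + ε))
        ⟨⟨_, rfl⟩, _, heq.symm⟩ ?_
      rw [ha]
      rcases hε with rfl | rfl <;> omega
    have hsign : ∀ k k₀ : ℤ, ∃ ε : ℤ, (ε = 1 ∨ ε = -1) ∧ (k = k₀ ∨ 0 < (k - k₀) * ε) := by
      intro k k₀
      rcases le_total k k₀ with h | h
      · exact ⟨-1, by simp, by omega⟩
      · exact ⟨1, by simp, by omega⟩
    obtain ⟨ε, hε, hε'⟩ := hsign i i₀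
    obtain ⟨δ, hδ, hδ'⟩ := hsign j j₀
    rw [hD, dist_of_diverging hX ha hb h0 hε hδ (hne ε δ hε hδ) hε' hδ']
    omega
  -- For a positive distance, the first alternative of `q1` is impossible and the second is the
  -- lower bound.
  · have q1 := four_point hX (a i₀) (b j) (a i) (b j₀)
    have q2 := four_point hX (a i₀) (b j₀) (a i) (b j)
    have c1 := X.dist_comm (u := b j) (v := a i)
    have c2 := X.dist_comm (u := b j₀) (v := a i)
    have c3 := X.dist_comm (u := b j₀) (v := b j)
    omega

/-! ### Schottky pairs -/

/-- The distance between points on different sides of an edge. -/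
lemma dist_of_mem_halfTree (hX : X.IsTree) {p n x y : V} (hpn : X.dist p n = 1)
    (hx : x ∈ halfTree X p n) (hy : y ∉ halfTree X p n) :
    X.dist x y = X.dist x n + 1 + X.dist p y := by
  simp only [halfTree, Set.mem_ofPred_eq] at hx hy
  have h1 := dist_neighbor hX x hpn
  have h2 := dist_neighbor hX y hpn
  have c1 := X.dist_comm (u := n) (v := y)
  have c2 := X.dist_comm (u := p) (v := y)
  have c3 := X.dist_comm (u := n) (v := p)
  have := dist_add_of_turn hX (x := n) (y := x) (z := y) (v := p) (by omega) (by omega) (by omega)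
  omega

/-- The hypothesis says that the edges point away from each other. From a point of the first
half-tree, both `p'` and `n'` are reached through the first edge, and `p'` comes first. -/
lemma disjoint_halfTree (hX : X.IsTree) {p n p' n' : V} (hpn : X.dist p n = 1)
    (hpn' : X.dist p' n' = 1) (h : X.dist n n' = X.dist p p' + 2) :
    Disjoint (halfTree X p n) (halfTree X p' n') := by
  rw [Set.disjoint_left]
  intro x hx hx'
  have t1 := dist_triangle hX n p' n'
  have t2 := dist_triangle hX p p' n'
  have c1 := X.dist_comm (u := n) (v := n')
  have c2 := X.dist_comm (u := n) (v := p')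
  have c3 := X.dist_comm (u := p) (v := n')
  have c4 := X.dist_comm (u := p) (v := p')
  have e1 := dist_neighbor hX p' hpn
  have e2 := dist_neighbor hX n' hpn
  have e3 := dist_neighbor hX p hpn'
  have d1 := dist_of_mem_halfTree hX hpn hx (y := p') (by
    simp only [halfTree, Set.mem_ofPred_eq]; omega)
  have d2 := dist_of_mem_halfTree hX hpn hx (y := n') (by
    simp only [halfTree, Set.mem_ofPred_eq]; omega)
  simp only [halfTree, Set.mem_ofPred_eq] at hx'
  omega

lemma image_compl_halfTree (hX : X.IsTree) (g : X ≃g X) {p n : V} (hpn : X.dist p n = 1) :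
    g '' (halfTree X p n)ᶜ = halfTree X (g n) (g p) := by
  ext x
  obtain ⟨y, rfl⟩ := g.surjective x
  rw [g.injective.mem_set_image]
  simp only [halfTree, Set.mem_compl_iff, Set.mem_ofPred_eq, dist_apply]
  have := dist_neighbor hX y hpn
  omega

/-- Automorphisms `g` and `h`, which shift the lines `a` and `b`, form a Schottky pair if four
suitable edges of these lines point away from each other. -/
lemma isSchottkyPair_of_lines (hX : X.IsTree) {g h : X ≃g X} {a b : ℤ → V} {m n s t : ℤ}
    (hm : 0 < m) (hn : 0 < n) (ha : IsLine X a) (hb : IsLine X b) (hg : Shifts g a m)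
    (hh : Shifts h b n)
    (h00 : X.dist (a (s - 1)) (b (t - 1)) = X.dist (a s) (b t) + 2)
    (h01 : X.dist (a (s - 1)) (b (t + n)) = X.dist (a s) (b (t + n - 1)) + 2)
    (h10 : X.dist (a (s + m)) (b (t - 1)) = X.dist (a (s + m - 1)) (b t) + 2)
    (h11 : X.dist (a (s + m)) (b (t + n)) = X.dist (a (s + m - 1)) (b (t + n - 1)) + 2) :
    IsSchottkyPair g h := by
  have ea : ∀ i j, i - j = 1 ∨ j - i = 1 → X.dist (a i) (a j) = 1 := by
    intro i j h; rw [ha]; omega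
  have eb : ∀ i j, i - j = 1 ∨ j - i = 1 → X.dist (b i) (b j) = 1 := by
    intro i j h; rw [hb]; omega
  have a0 := ea s (s - 1) (by omega)
  have a1 := ea (s + m - 1) (s + m) (by omega)
  have b0 := eb t (t - 1) (by omega)
  have b1 := eb (t + n - 1) (t + n) (by omega)
  have daa : Disjoint (halfTree X (a s) (a (s - 1))) (halfTree X (a (s + m - 1)) (a (s + m))) :=
    disjoint_halfTree hX a0 a1 (by rw [ha, ha]; omega)
  have dbb : Disjoint (halfTree X (b t) (b (t - 1))) (halfTree X (b (t + n - 1)) (b (t + n))) :=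
    disjoint_halfTree hX b0 b1 (by rw [hb, hb]; omega)
  have d00 := disjoint_halfTree hX a0 b0 h00
  have d01 := disjoint_halfTree hX a0 b1 h01
  have d10 := disjoint_halfTree hX a1 b0 h10
  have d11 := disjoint_halfTree hX a1 b1 h11
  -- The edge before `a s` is carried to the edge before `a (s + m)`. The inner endpoint of the
  -- former goes to the outer endpoint of the latter, which turns the complement of one half-tree
  -- into the other.
  refine ⟨![![a s, a (s + m - 1)], ![b t, b (t + n - 1)]],
    ![![a (s - 1), a (s + m)], ![b (t - 1), b (t + n)]], ?_, ?_, ?_⟩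
  · intro i j
    fin_cases i <;> fin_cases j
    exacts [SimpleGraph.dist_eq_one_iff_adj.1 a0, SimpleGraph.dist_eq_one_iff_adj.1 a1,
      SimpleGraph.dist_eq_one_iff_adj.1 b0, SimpleGraph.dist_eq_one_iff_adj.1 b1]
  · intro i j i' j' hne
    fin_cases i <;> fin_cases j <;> fin_cases i' <;> fin_cases j' <;>
      first
      | exact absurd rfl hne
      | assumption
      | (apply Disjoint.symm; assumption)
  · intro i
    fin_cases i
    · have h1 : g (a (s - 1)) = a (s + m - 1) := by rw [hg]; congr 1; ring
      refine ⟨h1, hg s, ?_⟩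
      have := image_compl_halfTree hX g a0
      rw [h1, hg] at this
      exact this
    · have h1 : h (b (t - 1)) = b (t + n - 1) := by rw [hh]; congr 1; ring
      refine ⟨h1, hh t, ?_⟩
      have := image_compl_halfTree hX h b0
      rw [h1, hh] at this
      exact this

/-- Hyperbolic automorphisms whose axes have no common edge form a Schottky pair. -/
lemma isSchottkyPair_of_disjoint_axes (hX : X.IsTree) {g h : X ≃g X} (hg : IsHyperbolic g)
    (hh : IsHyperbolic h) (hl : pathLength X (axis g ∩ axis h) = 0) : IsSchottkyPair g h := by
  obtain ⟨a, ha, hga, hgp⟩ := hg.exists_line hX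
  obtain ⟨b, hb, hhb, hhp⟩ := hh.exists_line hX
  rw [axis_of_shifts hX (by omega) ha hga, axis_of_shifts hX (by omega) hb hhb] at hl
  obtain ⟨i₀, j₀, D, hD⟩ := exists_bridge hX ha hb hl
  apply isSchottkyPair_of_lines hX (s := i₀) (t := j₀) (by omega) (by omega) ha hb hga hhb <;>
    simp only [hD] <;> omega

/-- Hyperbolic automorphisms whose axes overlap in a path shorter than both translation lengths
form a Schottky pair. -/
lemma AxisPair.isSchottkyPair (hX : X.IsTree) {g h : X ≃g X} {m n s e : ℤ} {a b : ℤ → V}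
    (P : AxisPair g h m n a b (Set.Icc s e)) (hse : s < e) (hm : e - s < m) (hn : e - s < n) :
    IsSchottkyPair g h := by
  -- Cutting both axes just below the overlap works: as it is shorter than `m` and `n`, the upper
  -- edges lie beyond its end.
  refine isSchottkyPair_of_lines hX (s := s) (t := s) P.left_pos P.right_pos P.left_line
    P.right_line P.left_shifts P.right_shifts ?_ ?_ ?_ ?_
  · have e1 := P.dist_left_left hX hse.le (i := s - 1) (j := s - 1) (by omega) (by omega)
    have e2 := P.dist_left_left hX hse.le (i := s) (j := s) (by omega) (by omega)
    omega
  · have e1 := P.symm.dist_right_left hX hse (i := s + n) (j := s - 1) (by omega) (by omega)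
    have e2 := P.symm.dist_right_left hX hse (i := s + n - 1) (j := s) (by omega) (by omega)
    rw [X.dist_comm] at e1 e2
    omega
  · have e1 := P.dist_right_left hX hse (i := s + m) (j := s - 1) (by omega) (by omega)
    have e2 := P.dist_right_left hX hse (i := s + m - 1) (j := s) (by omega) (by omega)
    omega
  · have e1 := P.dist_right_right hX hse.le (i := s + m) (j := s + n) (by omega) (by omega)
    have e2 := P.dist_right_right hX hse.le (i := s + m - 1) (j := s + n - 1) (by omega) (by omega)
    omega

open scoped Pointwise in
/-- The ping-pong lemma for Schottky pairs. -/
lemma IsSchottkyPair.freeOfRankTwo.{u} {V : Type u} {X : SimpleGraph V} {g h : X ≃g X}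
    (hS : IsSchottkyPair g h) : FreeOfRankTwo (Subgroup.closure {g, h}) := by
  obtain ⟨p, n, hadj, hdisj, hact⟩ := hS
  let _ : MulAction (X ≃g X) V :=
    { smul := fun f v => f v, one_smul := fun _ => rfl, mul_smul := fun _ _ _ => rfl }
  have hsmul : ∀ (f : X ≃g X) (S : Set V), f • S = f '' S := fun _ _ => rfl
  have hinj : Function.Injective
      (FreeGroup.lift fun i : ULift.{u} (Fin 2) => ![g, h] i.down) := by
    refine FreeGroup.injective_lift_of_ping_pong _
      (fun i => halfTree X (p i.down 1) (n i.down 1))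
      (fun i => halfTree X (p i.down 0) (n i.down 0)) ?_ ?_ ?_ ?_ ?_ ?_
    · intro i
      refine ⟨n i.down 1, ?_⟩
      simp only [halfTree, Set.mem_ofPred_eq, SimpleGraph.dist_self]
      rw [SimpleGraph.dist_eq_one_iff_adj.2 (hadj i.down 1).symm]
      exact Nat.one_pos
    · intro i j hij
      exact hdisj _ _ _ _ fun h => hij (ULift.down_injective (Prod.ext_iff.1 h).1)
    · intro i j hij
      exact hdisj _ _ _ _ fun h => hij (ULift.down_injective (Prod.ext_iff.1 h).1)
    · intro i j
      exact hdisj _ _ _ _ (by simp)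
    · intro i
      rw [hsmul]
      exact (hact i.down).2.2.le
    · intro i
      -- The inclusion for the inverse is the same equality after taking complements.
      have h1 := (hact i.down).2.2
      rw [Pi.inv_apply, Set.smul_set_subset_iff_subset_inv_smul_set, inv_inv, hsmul,
        Set.compl_subset_comm, ← Set.image_compl_eq (RelIso.bijective _)]
      exact h1.le
  have hrange : (FreeGroup.lift fun i : ULift.{u} (Fin 2) => ![g, h] i.down).range =
      Subgroup.closure {g, h} := by
    rw [FreeGroup.range_lift_eq_closure]
    congr 1
    ext x
    simp [Fin.exists_fin_two, eq_comm]
  rw [← hrange]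
  exact ⟨(MonoidHom.ofInjective hinj).symm.trans (FreeGroup.freeGroupCongr Equiv.ulift)⟩

/-! ### Overlap equal to a translation length -/

namespace AxisPair

variable {g h : X ≃g X} {m n : ℤ} {a b : ℤ → V} {s e : ℤ}

/-- If the overlap of the axes has length `n`, then the axis of `g` and its image under `h` meet
in a path or ray starting at `a e`. -/
lemma range_inter_image (hX : X.IsTree) (P : AxisPair g h m n a b (Set.Icc s e))
    (hse : s + n = e) :
    Set.range a ∩ h '' Set.range a = a '' {i | e ≤ i ∧ a i = h (a (s + e - i))} := by
  have hn := P.right_pos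
  have he := (P.mem_iff e).1 ⟨by omega, le_rfl⟩
  have hs := (P.mem_iff s).1 ⟨le_rfl, by omega⟩
  have hL := P.left_line.map h
  have h0 : a e = h (a s) := by rw [hs, P.right_shifts, hse, he]
  have hout : ∀ i, i ∉ Set.Icc s e → a i ≠ b i := fun i hi h => hi ((P.mem_iff i).2 h)
  have hb1 : b (e - 1) = a (e - 1) := ((P.mem_iff _).1 ⟨by omega, by omega⟩).symm
  have hs1 : h (a (s + 1)) = b (e + 1) := by
    rw [(P.mem_iff (s + 1)).1 ⟨by omega, by omega⟩, P.right_shifts]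
    congr 1
    omega
  -- At `a e = h (a s)`, three of the four pairs of directions diverge. The lines can only continue
  -- together upward on `a` and downward on its image.
  have n1 : a (e + 1) ≠ h (a (s + 1)) := by
    rw [hs1]
    exact hout _ (by simp)
  have n2 : a (e + -1) ≠ h (a (s + 1)) := by
    rw [hs1, ← sub_eq_add_neg, ← hb1]
    intro h
    have := P.right_line.injective h
    omega
  have n3 : a (e + -1) ≠ h (a (s + -1)) := by
    rw [← sub_eq_add_neg, ← hb1, show e - 1 = s + -1 + n by omega, ← P.right_shifts]
    intro h'
    exact hout (s + -1) (by simp) (h.injective h').symm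
  ext x
  constructor
  · rintro ⟨⟨i, rfl⟩, _, ⟨j, rfl⟩, hj⟩
    have e1 := P.left_line e i
    have e2 := hL s j
    simp only [hj, ← h0] at e2
    have hsub : ∀ ε δ : ℤ, (ε = 1 ∨ ε = -1) → (δ = 1 ∨ δ = -1) → a (e + ε) ≠ h (a (s + δ)) →
        ¬ (0 < (i - e) * ε ∧ 0 < (j - s) * δ) := by
      rintro ε δ hε hδ hne ⟨h1, h2⟩
      have := dist_of_diverging hX P.left_line hL h0 hε hδ hne (Or.inr h1) (Or.inr h2)
      simp only [hj, SimpleGraph.dist_self] at this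
      rcases hε with rfl | rfl <;> omega
    have s1 := hsub 1 1 (by simp) (by simp) n1
    have s2 := hsub (-1) 1 (by simp) (by simp) n2
    have s3 := hsub (-1) (-1) (by simp) (by simp) n3
    refine ⟨i, ⟨by omega, ?_⟩, rfl⟩
    rw [← hj]
    congr 2
    omega
  · rintro ⟨i, ⟨-, hi⟩, rfl⟩
    exact ⟨⟨i, rfl⟩, _, ⟨_, rfl⟩, hi.symm⟩

lemma ordConnected_return (hX : X.IsTree) (P : AxisPair g h m n a b (Set.Icc s e)) :
    {i | e ≤ i ∧ a i = h (a (s + e - i))}.OrdConnected := by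
  constructor
  have hL : IsLine X fun i => h (a (s + e - i)) := by
    intro i j
    simp only
    rw [dist_apply, P.left_line]
    omega
  rintro i ⟨hi, hi'⟩ j ⟨hj, hj'⟩ k ⟨hik, hkj⟩
  exact ⟨by omega, P.left_line.eq_of_eq_of_eq hX hL hik hkj hi' hj'⟩

/-- If the overlap of the axes has length `n ≤ m`, this is the displacement of the points of the
axis of `h` under `g * h⁻¹`. -/
lemma dist_mul_inv_apply (hX : X.IsTree) (P : AxisPair g h m n a b (Set.Icc s e))
    (hse : s + n = e) (hnm : n ≤ m) (i : ℤ) :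
    (X.dist (b i) ((g * h⁻¹) (b i)) : ℤ) = m - n + 2 * (i - e).natAbs := by
  have hn := P.right_pos
  have hse' : s < e := by omega
  have hfb := P.mul_inv_apply_right
  set f := g * h⁻¹ with hf
  have he : b e = a e := ((P.mem_iff e).1 ⟨hse'.le, le_rfl⟩).symm
  have hfe : f (b e) = a (e + (m - n)) := by
    rw [he, P.mul_inv_apply ⟨hse'.le, le_rfl⟩ ⟨by omega, by omega⟩]
    congr 1
    ring
  have hL := P.right_line.map f
  rcases lt_trichotomy i e with hi | rfl | hi
  -- The geodesic climbs `b` to `b e`, follows `a` to `f (b e)` and there turns off along the image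
  -- of `b`.
  · have e1 := P.dist_right_left hX hse' (i := e + (m - n)) (j := i) (by omega) hi.le
    have e2 : (X.dist (a (e + (m - n) - 1)) (b i) : ℤ) = e + (m - n) - 1 - i := by
      rcases hnm.lt_or_eq with hnm | rfl
      · exact P.dist_right_left hX hse' (by omega) hi.le
      · rw [sub_self, add_zero, (P.mem_iff (e - 1)).1 ⟨by omega, by omega⟩, P.right_line]
        omega
    have hne : a (e + (m - n) - 1) ≠ f (b (e - 1)) := by
      intro h
      rw [hfb, show e + (m - n) - 1 = e - 1 - n + m by ring, ← P.left_shifts] at h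
      have := (P.mem_iff _).2 (g.injective h)
      simp only [Set.mem_Icc] at this
      omega
    have l1 := hL e (e - 1)
    have l2 := hL e i
    have l3 := hL (e - 1) i
    simp only [hfe] at l1 l2 l3
    have l4 := P.left_line (e + (m - n) - 1) (e + (m - n))
    have c1 := X.dist_comm (u := f (b (e - 1))) (v := a (e + (m - n)))
    have c2 := X.dist_comm (u := a (e + (m - n))) (v := b i)
    have c3 := X.dist_comm (u := a (e + (m - n) - 1)) (v := b i)
    have ht := dist_neighbor_of_ne hX (x := a (e + (m - n))) (y := b i) (u := a (e + (m - n) - 1))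
      (v := f (b (e - 1))) (by omega) (by omega) (by omega) hne
    have := dist_add_of_turn hX (x := a (e + (m - n))) (y := b i) (v := f (b (e - 1)))
      (z := f (b i)) (by omega) (by omega) ht
    omega
  · rw [hfe, he, P.left_line]
    omega
  -- The geodesic descends `b` to `b e`, follows `a` to `f (b e)` and continues along the image of
  -- `b`, whose next vertex is on `a`.
  · have e1 := P.dist_right_right hX hse'.le (i := e + (m - n)) (j := i) (by omega) hi.le
    have e2 := P.dist_right_right hX hse'.le (i := e + (m - n) + 1) (j := i) (by omega) hi.le
    have hv : f (b (e + 1)) = a (e + (m - n) + 1) := by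
      rw [hfb, ← (P.mem_iff (e + 1 - n)).1 ⟨by omega, by omega⟩, P.left_shifts]
      congr 1
      ring
    have l1 := hL e (e + 1)
    have l2 := hL e i
    have l3 := hL (e + 1) i
    simp only [hfe, hv] at l1 l2 l3
    have c2 := X.dist_comm (u := a (e + (m - n))) (v := b i)
    have c3 := X.dist_comm (u := a (e + (m - n) + 1)) (v := b i)
    have := dist_add_of_turn hX (x := a (e + (m - n))) (y := b i) (v := a (e + (m - n) + 1))
      (z := f (b i)) (by omega) (by omega) (by omega)
    omega

lemma mul_inv_apply_return (P : AxisPair g h m n a b (Set.Icc s e)) {i : ℤ}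
    (hi : a i = h (a (s + e - i))) : (g * h⁻¹) (a i) = a (s + e - i + m) := by
  rw [RelIso.mul_apply, hi, RelIso.inv_apply_self, P.left_shifts]

/-- If the axis of `g` and its image under `h` have a long overlap, then `g * h⁻¹` is elliptic. -/
lemma elliptic_of_return (hX : X.IsTree) (P : AxisPair g h m n a b (Set.Icc s e))
    (hse : s + n = e) (hnm : n ≤ m) (hinv : ¬ IsInversion (g * h⁻¹)) {r : ℕ}
    (hr : r = (m - n + 1) / 2) (hret : a (e + r) = h (a (s - r))) :
    m - n = 2 * r ∧ IsElliptic (g * h⁻¹) ∧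
      pathLength X (Set.range b ∩ fixedTree (g * h⁻¹)) = 0 ∧
      setDist X (Set.range b) (fixedTree (g * h⁻¹)) = r := by
  have hn := P.right_pos
  have hdisp := P.dist_mul_inv_apply hX hse hnm
  have hret0 : e + (r : ℤ) ∈ {i | e ≤ i ∧ a i = h (a (s + e - i))} :=
    ⟨by omega, by rw [hret]; congr 2; ring⟩
  have he := (P.mem_iff e).1 ⟨by omega, le_rfl⟩
  have hee : e ∈ {i | e ≤ i ∧ a i = h (a (s + e - i))} := by
    refine ⟨le_rfl, ?_⟩
    rw [add_sub_cancel_right, (P.mem_iff s).1 ⟨le_rfl, by omega⟩, P.right_shifts, hse, he]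
  -- On the stretch of return, `g * h⁻¹` acts on `a` as the reflection with center `e + (m - n) /
  -- 2`.
  have hmove : ∀ k : ℕ, k ≤ r → (g * h⁻¹) (a (e + k)) = a (e + (m - n) - k) := by
    intro k hk
    have := (P.ordConnected_return hX).out hee hret0
      (show e + (k : ℤ) ∈ Set.Icc e (e + (r : ℤ)) from ⟨by omega, by omega⟩)
    rw [P.mul_inv_apply_return this.2]
    congr 1
    omega
  -- For odd `m - n` the center is the midpoint of an edge, which would be inverted.
  have heven : m - n = 2 * r := by
    by_contra hodd
    apply hinv
    have h1 := hmove (r - 1) (by omega)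
    have h2 := hmove r le_rfl
    refine ⟨a (e + (r - 1 : ℕ)), a (e + r), ?_, ?_, ?_⟩
    · rw [← SimpleGraph.dist_eq_one_iff_adj, P.left_line]
      omega
    · rw [h1]; congr 1; omega
    · rw [h2]; congr 1; omega
  have hfix : a (e + r) ∈ fixedTree (g * h⁻¹) := by
    change (g * h⁻¹) (a (e + r)) = a (e + r)
    rw [hmove r le_rfl]
    congr 1
    omega
  refine ⟨heven, ⟨_, hfix⟩, ?_, ?_⟩
  · rw [pathLength_eq_zero_iff]
    rintro _ ⟨⟨i, rfl⟩, hi⟩ _ ⟨⟨j, rfl⟩, hj⟩ hij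
    have d1 := hdisp i
    have d2 := hdisp j
    rw [show (g * h⁻¹) (b i) = b i from hi, SimpleGraph.dist_self] at d1
    rw [show (g * h⁻¹) (b j) = b j from hj, SimpleGraph.dist_self] at d2
    rw [P.right_line] at hij
    omega
  · apply le_antisymm
    · refine Nat.sInf_le ⟨b e, ⟨e, rfl⟩, _, hfix, ?_⟩
      rw [← he, P.left_line]
      omega
    · refine le_csInf ⟨_, b e, ⟨e, rfl⟩, _, hfix, rfl⟩ ?_
      -- The displacement of `b i`, at least `2 * r`, is at most twice its distance to a fixed
      -- vertex.
      rintro _ ⟨_, ⟨i, rfl⟩, x, hx, rfl⟩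
      have d := hdisp i
      have t := dist_triangle hX (b i) x ((g * h⁻¹) (b i))
      have d2 := dist_apply (g * h⁻¹) x (b i)
      rw [show (g * h⁻¹) x = x from hx] at d2
      have c := X.dist_comm (u := x) (v := b i)
      omega

/-- If the axis of `g` and its image under `h` have a short overlap, then `g * h⁻¹` is hyperbolic,
and its axis is disjoint from the axis of `h`. -/
lemma hyperbolic_of_return (hX : X.IsTree) (P : AxisPair g h m n a b (Set.Icc s e))
    (hse : s + n = e) (hnm : n ≤ m) {L : ℕ} (hL : 2 * L < m - n)
    (hret : a (e + L) = h (a (s - L))) (hret' : a (e + L + 1) ≠ h (a (s - L - 1))) :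
    IsHyperbolic (g * h⁻¹) ∧ (translationLength (g * h⁻¹) : ℤ) = m - n - 2 * L ∧
      pathLength X (Set.range b ∩ axis (g * h⁻¹)) = 0 ∧
      setDist X (Set.range b) (axis (g * h⁻¹)) = L := by
  have hn := P.right_pos
  have hdisp := P.dist_mul_inv_apply hX hse hnm
  have he := (P.mem_iff e).1 ⟨by omega, le_rfl⟩
  obtain ⟨t, ht⟩ : ∃ t : ℕ, m - n - 2 * L = t := ⟨(m - n - 2 * L).toNat, by omega⟩
  set f := g * h⁻¹ with hf
  have h1 : f (a (e + L)) = a (e + L + t) := by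
    rw [hf, P.mul_inv_apply_return (i := e + L) (by rw [hret]; congr 2; ring)]
    congr 1
    omega
  -- The return stops after exactly `L` steps, so there is no backtracking at `a (e + L)`, which
  -- therefore lies on the axis of `f`.
  have hne : a (e + L + t - 1) ≠ f (a (e + L + 1)) := by
    intro h'
    apply hret'
    rw [hf, RelIso.mul_apply, show e + L + t - 1 = s - L - 1 + m by omega, ← P.left_shifts] at h'
    rw [g.injective h', RelIso.apply_inv_self]
  have d1 := P.left_line (e + L) (e + L + t)
  have d2 := P.left_line (e + L) (e + L + 1)
  have d3 := P.left_line (e + L + 1) (e + L + t)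
  have d4 := P.left_line (e + L + t - 1) (e + L + t)
  have d5 := P.left_line (e + L) (e + L + t - 1)
  have d6 := dist_apply f (a (e + L)) (a (e + L + 1))
  rw [← h1] at d1 d3 d4
  have c := X.dist_comm (u := f (a (e + L))) (v := f (a (e + L + 1)))
  have ht1 := dist_neighbor_of_ne hX (x := f (a (e + L))) (y := a (e + L))
    (u := a (e + L + t - 1)) (v := f (a (e + L + 1))) (by omega) (by omega) (by omega) hne
  obtain ⟨c, hc, hc0, hcf⟩ := exists_line_of_neighbor hX f (p := a (e + L)) (p' := a (e + L + 1))
    (t := t) (by omega) (by omega) (by omega) (by omega) (by omega)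
  have htp : (0 : ℤ) < t := by omega
  -- Comparing displacements on the two lines gives `L + |i - e|` as a lower bound for the distance
  -- of `b i` to the axis of `f`.
  have hdc : ∀ i k, (m - n + 2 * (i - e).natAbs : ℤ) ≤ t + 2 * X.dist (b i) (c k) := by
    intro i k
    have e1 := hdisp i
    have e2 := dist_apply_line htp hc hcf k
    have e3 := dist_apply f (b i) (c k)
    have t1 := dist_triangle hX (b i) (c k) (f (b i))
    have t2 := dist_triangle hX (c k) (f (c k)) (f (b i))
    have c1 := X.dist_comm (u := f (c k)) (v := f (b i))
    omega
  rw [axis_of_shifts hX htp hc hcf]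
  refine ⟨isHyperbolic_of_shifts hX htp hc hcf, ?_, ?_, ?_⟩
  · rw [translationLength_of_shifts hX htp hc hcf, ht]
  · rw [pathLength_eq_zero_iff]
    rintro _ ⟨⟨i, rfl⟩, k, hk⟩ _ ⟨⟨j, rfl⟩, k', hk'⟩ hij
    have e1 := hdc i k
    have e2 := hdc j k'
    rw [hk, SimpleGraph.dist_self] at e1
    rw [hk', SimpleGraph.dist_self] at e2
    rw [P.right_line] at hij
    omega
  · have hmem : ∃ s ∈ Set.range b, ∃ t ∈ Set.range c, L = X.dist s t := by
      refine ⟨b e, ⟨e, rfl⟩, c 0, ⟨0, rfl⟩, ?_⟩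
      rw [← he, hc0, P.left_line]
      omega
    apply le_antisymm
    · exact Nat.sInf_le hmem
    · refine le_csInf ⟨_, hmem⟩ ?_
      rintro _ ⟨_, ⟨i, rfl⟩, _, ⟨k, rfl⟩, rfl⟩
      have := hdc i k
      omega

end AxisPair

/-! ### Torsion -/

lemma finite_ball (hX : X.IsTree) (hfin : ∀ v, (X.neighborSet v).Finite) (v : V) (n : ℕ) :
    {x | X.dist v x ≤ n}.Finite := by
  induction n with
  | zero =>
    refine (Set.finite_singleton v).subset fun x hx => ?_
    exact ((dist_eq_zero_iff hX).1 (Nat.le_zero.1 hx)).symm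
  | succ n ih =>
    refine (ih.union (ih.biUnion fun x _ => hfin x)).subset fun x hx => ?_
    simp only [Set.mem_ofPred_eq] at hx
    by_cases h : X.dist v x ≤ n
    · exact Or.inl h
    · obtain ⟨y, h1, h2⟩ := exists_between hX v x (i := n) (by omega)
      refine Or.inr (Set.mem_biUnion (x := y) (show X.dist v y ≤ n by omega) ?_)
      exact SimpleGraph.dist_eq_one_iff_adj.1 (by omega)

/-- Elliptic elements of discrete groups of automorphisms of a locally finite tree have finite
order. -/
lemma isOfFinOrder_of_isElliptic (hX : X.IsTree) (hfin : ∀ v, (X.neighborSet v).Finite)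
    {Γ : Subgroup (X ≃g X)} (hdisc : IsDiscrete Γ) {f : X ≃g X} (hf : f ∈ Γ)
    (hell : IsElliptic f) : IsOfFinOrder f := by
  obtain ⟨v, hv⟩ := hell
  obtain ⟨T, hT, -, hstab⟩ := hdisc
  obtain ⟨n, hn⟩ : ∃ n, ∀ x ∈ T, X.dist v x ≤ n := by
    obtain ⟨n, hn⟩ := (hT.image (X.dist v)).bddAbove
    exact ⟨n, fun x hx => hn ⟨x, hx, rfl⟩⟩
  set B := {x | X.dist v x ≤ n} with hB
  have hBfin : B.Finite := finite_ball hX hfin v n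
  have hpow : ∀ k : ℕ, (f ^ k) v = v := by
    intro k
    induction k with
    | zero => rfl
    | succ k ih => rw [pow_succ, RelIso.mul_apply, hv, ih]
  have hmaps : ∀ k : ℕ, ∀ x : B, (f ^ k) x ∈ B := by
    intro k x
    have := dist_apply (f ^ k) v x
    rw [hpow] at this
    exact this.trans_le x.2
  have : Finite B := hBfin
  -- Two powers of `f` agree on a finite ball that contains `T`, so a positive power fixes `T`
  -- pointwise and is trivial.
  obtain ⟨k, l, hkl, heq⟩ := Finite.exists_ne_map_eq_of_infinite
    fun (k : ℕ) (x : B) => (⟨(f ^ k) x, hmaps k x⟩ : B)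
  wlog hlt : k < l generalizing k l
  · exact this l k hkl.symm heq.symm (by omega)
  rw [isOfFinOrder_iff_pow_eq_one]
  refine ⟨l - k, by omega, hstab _ (pow_mem hf _) fun x hx => ?_⟩
  have h1 := congrArg Subtype.val (congrFun heq ⟨x, hn x hx⟩)
  simp only at h1
  rw [show l = k + (l - k) by omega, pow_add, RelIso.mul_apply] at h1
  exact ((f ^ k).injective h1).symm

lemma not_isFreeGroup_of_isElliptic (hX : X.IsTree) (hfin : ∀ v, (X.neighborSet v).Finite)
    {Γ : Subgroup (X ≃g X)} (hdisc : IsDiscrete Γ) {f : X ≃g X} (hf : f ∈ Γ)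
    (hell : IsElliptic f) (hne : f ≠ 1) : ¬ IsFreeGroup Γ := by
  intro hfree
  have h1 : IsOfFinOrder (⟨f, hf⟩ : Γ) :=
    Submonoid.isOfFinOrder_coe.1 (isOfFinOrder_of_isElliptic hX hfin hdisc hf hell)
  have h2 := (IsFreeGroup.toFreeGroup Γ).toMonoidHom.isOfFinOrder h1
  rw [isOfFinOrder_iff_eq_one] at h2
  have h3 : (⟨f, hf⟩ : Γ) = 1 := by
    apply (IsFreeGroup.toFreeGroup Γ).injective
    rw [map_one]
    exact h2
  exact hne (congrArg Subtype.val h3)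

lemma FreeOfRankTwo.isFreeGroup {G : Type*} [Group G] (h : FreeOfRankTwo G) : IsFreeGroup G := by
  obtain ⟨e⟩ := h
  exact IsFreeGroup.ofMulEquiv e.symm

lemma not_freeOfRankTwo_of_commute {G : Type*} [Group G] (h : ∀ x y : G, x * y = y * x) :
    ¬ FreeOfRankTwo G := by
  rintro ⟨e⟩
  have h1 : (FreeGroup.of 0 : FreeGroup (Fin 2)) * FreeGroup.of 1 =
      FreeGroup.of 1 * FreeGroup.of 0 := by
    apply e.symm.injective
    rw [map_mul, map_mul, h]
  exact absurd h1 (by decide)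

/-- The group generated by a hyperbolic automorphism is free. -/
lemma isFreeGroup_zpowers {g : X ≃g X} (hX : X.IsTree) (hg : IsHyperbolic g) :
    IsFreeGroup (Subgroup.zpowers g) := by
  obtain ⟨a, ha, hga, hpos⟩ := hg.exists_line hX
  have hord : ¬ IsOfFinOrder g := by
    rw [isOfFinOrder_iff_pow_eq_one]
    rintro ⟨n, hn, h⟩
    have : ∀ k : ℕ, Shifts (g ^ k) a (k * translationLength g) := by
      intro k
      induction k with
      | zero => intro i; simp
      | succ k ih =>
        rw [pow_succ]
        have := ih.mul hga
        push_cast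
        rwa [show (k + 1 : ℤ) * translationLength g =
          translationLength g + k * translationLength g by ring]
    have h0 := this n 0
    rw [h] at h0
    have h1 := ha.injective (show a 0 = _ from h0)
    rw [zero_add] at h1
    exact (by positivity : (n : ℤ) * translationLength g ≠ 0) h1.symm
  have hinj : Function.Injective (zpowersHom (X ≃g X) g) := fun x y hxy =>
    injective_zpow_iff_not_isOfFinOrder.2 hord hxy
  have : IsFreeGroup (Multiplicative ℤ) := 
    IsFreeGroup.ofMulEquiv (FreeGroup.mulEquivIntOfUnique (α := Unit))
  have hrange : (zpowersHom (X ≃g X) g).range = Subgroup.zpowers g := rfl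
  rw [← hrange]
  exact IsFreeGroup.ofMulEquiv (MonoidHom.ofInjective hinj)

/-! ### The Euclidean algorithm -/

section Euclid

variable {a b : ℕ}

lemma euclidSeq_add_two (a b : ℕ) {i : ℕ} (hi : 1 ≤ i) :
    euclidSeq a b (i + 2) = euclidSeq a b i % euclidSeq a b (i + 1) := by
  obtain ⟨i, rfl⟩ := Nat.exists_eq_add_of_le' hi
  rw [Nat.mod_eq_sub_div_mul]
  rfl

lemma exists_euclidSeq_eq_zero (a b : ℕ) : ∃ k, euclidSeq a b (k + 1) = 0 := by
  by_contra! h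
  have key : ∀ i, euclidSeq a b (i + 2) + i ≤ euclidSeq a b 2 := by
    intro i
    induction i with
    | zero => simp
    | succ i ih =>
      have h1 := euclidSeq_add_two a b (i := i + 1) (by omega)
      have h2 := Nat.mod_lt (euclidSeq a b (i + 1)) (Nat.pos_of_ne_zero (h (i + 1)))
      simp only [add_assoc, Nat.reduceAdd] at h1 h2 ih ⊢
      omega
  have := key (euclidSeq a b 2 + 1)
  omega

lemma euclidSeq_last (a b : ℕ) : euclidSeq a b (euclidLast a b + 1) = 0 :=
  Nat.sInf_mem (exists_euclidSeq_eq_zero a b)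

lemma euclidSeq_pos {i : ℕ} (hi : 1 ≤ i) (hk : i ≤ euclidLast a b) : 0 < euclidSeq a b i := by
  obtain ⟨i, rfl⟩ := Nat.exists_eq_add_of_le' hi
  exact Nat.pos_of_ne_zero fun h => Nat.notMem_of_lt_sInf (Nat.lt_of_succ_le hk) h

lemma two_le_euclidLast (ha : 0 < a) (hb : 0 < b) : 2 ≤ euclidLast a b := by
  have := euclidSeq_last a b
  rcases h : euclidLast a b with _ | _ | k
  · rw [h] at this; exact absurd this ha.ne'
  · rw [h] at this; exact absurd this hb.ne'
  · omega

lemma euclidSeq_antitone (hab : b ≤ a) {i : ℕ} (hi : 1 ≤ i) (hk : i ≤ euclidLast a b) :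
    euclidSeq a b (i + 1) ≤ euclidSeq a b i := by
  rcases hi.eq_or_lt with rfl | hi
  · exact hab
  · obtain ⟨i, rfl⟩ := Nat.exists_eq_add_of_le' hi
    exact (euclidSeq_add_two a b (i := i + 1) (by omega)).trans_le
      (Nat.mod_lt _ (euclidSeq_pos (by omega) hk)).le

lemma euclidSeq_gcd {i : ℕ} (hi : 1 ≤ i) :
    Nat.gcd (euclidSeq a b i) (euclidSeq a b (i + 1)) = Nat.gcd a b := by
  induction i, hi using Nat.le_induction with
  | base => rfl
  | succ i hi ih =>
    rw [euclidSeq_add_two a b hi, Nat.gcd_comm, ← Nat.gcd_rec, Nat.gcd_comm, ih]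

lemma euclidSeq_euclidLast (ha : 0 < a) (hb : 0 < b) :
    euclidSeq a b (euclidLast a b) = Nat.gcd a b := by
  have := two_le_euclidLast ha hb
  have h := euclidSeq_gcd (a := a) (b := b) (i := euclidLast a b) (by omega)
  rwa [euclidSeq_last, Nat.gcd_zero_right] at h

lemma one_le_euclidQuot (hab : b ≤ a) {i : ℕ} (hi : 1 ≤ i) (hk : i + 1 ≤ euclidLast a b) :
    1 ≤ euclidQuot a b i :=
  Nat.div_pos (euclidSeq_antitone hab hi (by omega)) (euclidSeq_pos (by omega) hk)

lemma euclidSeq_eq (a b : ℕ) {i : ℕ} (hi : 1 ≤ i) :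
    euclidSeq a b i =
      euclidQuot a b i * euclidSeq a b (i + 1) + euclidSeq a b (i + 2) := by
  rw [euclidSeq_add_two a b hi, euclidQuot, mul_comm, Nat.div_add_mod]

/-- The lower end of the window with index `(j, q)`. -/
def windowStart (a b j q : ℕ) : ℤ :=
  (a + b : ℤ) - euclidSeq a b j + (q - 1 : ℤ) * euclidSeq a b (j + 1)

lemma windowStart_succ (a b j q : ℕ) :
    windowStart a b j (q + 1) = windowStart a b j q + euclidSeq a b (j + 1) := by
  simp only [windowStart]
  push_cast
  ring

/-- Consecutive stages of the algorithm share a threshold, so the windows tile the interval from `0`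
to `a + b - gcd` without gaps or overlaps. -/
lemma windowStart_quot (a b : ℕ) {j : ℕ} (hj : 1 ≤ j) :
    windowStart a b j (euclidQuot a b j) = windowStart a b (j + 1) 0 := by
  have h := euclidSeq_eq a b hj
  simp only [windowStart]
  rw [h]
  push_cast
  ring

lemma windowStart_one_zero (a b : ℕ) : windowStart a b 1 0 = 0 := by
  simp only [windowStart, euclidSeq]
  push_cast
  ring

lemma windowStart_last (ha : 0 < a) (hb : 0 < b) :
    windowStart a b (euclidLast a b) 0 = (a + b : ℤ) - Nat.gcd a b := by
  simp only [windowStart]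
  rw [euclidSeq_last, euclidSeq_euclidLast ha hb]
  push_cast
  ring

lemma windowStart_mono (a b j : ℕ) : Monotone (windowStart a b j) :=
  monotone_nat_of_le_succ fun q => by rw [windowStart_succ]; omega

lemma windowStart_zero_mono (a b : ℕ) : Monotone fun i => windowStart a b (i + 1) 0 :=
  monotone_nat_of_le_succ fun i => by
    rw [← windowStart_quot a b (j := i + 1) (by omega)]
    exact windowStart_mono a b _ (Nat.zero_le _)

lemma windowStart_nonneg (a b q : ℕ) {j : ℕ} (hj : 1 ≤ j) : 0 ≤ windowStart a b j q := by
  obtain ⟨j, rfl⟩ := Nat.exists_eq_add_of_le' hj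
  rw [← windowStart_one_zero a b]
  exact (windowStart_zero_mono a b (Nat.zero_le j)).trans (windowStart_mono a b _ (Nat.zero_le q))

lemma inWindow_iff {k L j q : ℕ} :
    InWindow (euclidSeq a b) (euclidQuot a b) k L j q ↔
      1 ≤ j ∧ j + 1 ≤ k ∧ q + 1 ≤ euclidQuot a b j ∧ windowStart a b j q < L ∧
        (L : ℤ) ≤ windowStart a b j (q + 1) := by
  simp only [InWindow, windowStart, euclidSeq]
  push_cast
  simp only [add_sub_cancel_right]

lemma exists_between_succ (f : ℕ → ℤ) (N : ℕ) {L : ℤ} (h0 : f 0 < L) (hN : L ≤ f N) :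
    ∃ i < N, f i < L ∧ L ≤ f (i + 1) := by
  induction N with
  | zero => omega
  | succ N ih =>
    by_cases h : L ≤ f N
    · obtain ⟨i, hi, h1⟩ := ih h
      exact ⟨i, by omega, h1⟩
    · exact ⟨N, by omega, by omega, hN⟩

lemma unique_between_succ {f : ℕ → ℤ} (hf : Monotone f) {L : ℤ} {i j : ℕ} (hi : f i < L)
    (hi' : L ≤ f (i + 1)) (hj : f j < L) (hj' : L ≤ f (j + 1)) : i = j := by
  rcases lt_trichotomy i j with h | h | h
  · have := hf (Nat.succ_le_of_lt h)
    simp only [Nat.succ_eq_add_one] at this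
    omega
  · exact h
  · have := hf (Nat.succ_le_of_lt h)
    simp only [Nat.succ_eq_add_one] at this
    omega

/-- The coarse thresholds `windowStart a b j 0` determine `j`; those within stage `j` then determine
`q`. -/
lemma existsUnique_inWindow (ha : 0 < a) (hb : 0 < b) {L : ℕ} (hL : 0 < L)
    (hL' : (L : ℤ) ≤ (a + b : ℤ) - Nat.gcd a b) :
    ∃! p : ℕ × ℕ,
      InWindow (euclidSeq a b) (euclidQuot a b) (euclidLast a b) L p.1 p.2 := by
  have hk := two_le_euclidLast ha hb
  simp only [inWindow_iff]
  obtain ⟨i, hi, hi1, hi2⟩ := exists_between_succ (fun i => windowStart a b (i + 1) 0)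
    (euclidLast a b - 1) (L := L) (by simp only [zero_add, windowStart_one_zero]; omega)
    (by simp only [show euclidLast a b - 1 + 1 = euclidLast a b by omega,
          windowStart_last ha hb]; exact hL')
  rw [← windowStart_quot a b (by omega)] at hi2
  obtain ⟨q, hq, hq1, hq2⟩ := exists_between_succ (windowStart a b (i + 1)) _ hi1 hi2
  refine ⟨(i + 1, q), ⟨by omega, by simp only; omega, hq, hq1, hq2⟩, ?_⟩
  rintro ⟨j, q'⟩ ⟨hj, hjk, hq', h1, h2⟩
  simp only at hj hjk hq' h1 h2
  obtain ⟨j, rfl⟩ := Nat.exists_eq_add_of_le' hj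
  rw [windowStart_quot a b (by omega)] at hi2
  have e1 := windowStart_mono a b (j + 1) (Nat.zero_le q')
  have e2 := windowStart_mono a b (j + 1) hq'
  rw [windowStart_quot a b (by omega)] at e2
  obtain rfl : j = i := unique_between_succ (windowStart_zero_mono a b) (L := L) (e1.trans_lt h1)
    (h2.trans e2) hi1 hi2
  obtain rfl : q' = q := unique_between_succ (windowStart_mono a b (j + 1)) h1 h2 hq1 hq2
  rfl

end Euclid

/-! ### The Euclidean algorithm for axis pairs -/

lemma closure_pair_mul_zpow {G : Type*} [Group G] (x y : G) (z : ℤ) :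
    Subgroup.closure {y, x * y ^ z} = Subgroup.closure {x, y} := by
  apply le_antisymm
  · rw [Subgroup.closure_le]
    have hx : x ∈ Subgroup.closure {x, y} := Subgroup.subset_closure (by simp)
    have hy : y ∈ Subgroup.closure {x, y} := Subgroup.subset_closure (by simp)
    rintro _ (rfl | rfl)
    · exact hy
    · exact mul_mem hx (zpow_mem hy z)
  · rw [Subgroup.closure_le]
    have hy : y ∈ Subgroup.closure {y, x * y ^ z} := Subgroup.subset_closure (by simp)
    have hx : x * y ^ z ∈ Subgroup.closure {y, x * y ^ z} := Subgroup.subset_closure (by simp)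
    rintro _ (rfl | rfl)
    · simpa using mul_mem hx (zpow_mem hy (-z))
    · exact hy

lemma elementSeq_add_two {G : Type*} [Group G] (Q : ℕ → ℕ) (x y : G) {i : ℕ} (hi : 1 ≤ i) :
    elementSeq Q x y (i + 2) =
      elementSeq Q x y i * elementSeq Q x y (i + 1) ^ (-(Q i : ℤ)) := by
  obtain ⟨i, rfl⟩ := Nat.exists_eq_add_of_le' hi
  rfl

lemma closure_elementSeq {G : Type*} [Group G] (Q : ℕ → ℕ) (x y : G) {i : ℕ} (hi : 1 ≤ i) :
    Subgroup.closure {elementSeq Q x y i, elementSeq Q x y (i + 1)} =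
      Subgroup.closure {x, y} := by
  induction i, hi using Nat.le_induction with
  | base => rfl
  | succ i hi ih => rw [elementSeq_add_two Q x y hi, closure_pair_mul_zpow, ih]

namespace AxisPair

variable {g h : X ≃g X} {m n : ℤ} {a b c d : ℤ → V} {I : Set ℤ}

/-- The subtractive step, with the overlap described as a part of an original overlap `I`. -/
lemma step_of_shift (hX : X.IsTree) (hI : I.OrdConnected) {w : ℤ} (hw : 0 ≤ w)
    (P : AxisPair g h m n c d {i | i ∈ I ∧ i - w ∈ I}) (hmn : n < m)
    (hov : ∃ i, i + 1 ∈ I ∧ i - (w + n) ∈ I) :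
    ∃ c', AxisPair (g * h⁻¹) h (m - n) n c' d {i | i ∈ I ∧ i - (w + n) ∈ I} := by
  have hn := P.right_pos
  obtain ⟨i, h1, h2⟩ := hov
  have hmem : ∀ k, i - (w + n) ≤ k → k ≤ i + 1 → k ∈ I := fun k hk hk' => hI.out h2 h1 ⟨hk, hk'⟩
  obtain ⟨c', P'⟩ := P.step hX hmn (i₀ := i) ⟨hmem _ (by omega) (by omega), hmem _ (by omega)
    (by omega)⟩ ⟨hmem _ (by omega) (by omega), hmem _ (by omega) (by omega)⟩
    ⟨hmem _ (by omega) (by omega), hmem _ (by omega) (by omega)⟩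
  refine ⟨c', ?_⟩
  convert P' using 1
  ext k
  simp only [Set.mem_ofPred_eq]
  rw [show k - n - w = k - (w + n) by ring]
  constructor
  · rintro ⟨h1, h2⟩
    exact ⟨⟨h1, hI.out h2 h1 ⟨by omega, by omega⟩⟩, hI.out h2 h1 ⟨by omega, by omega⟩, h2⟩
  · rintro ⟨⟨h1, -⟩, -, h2⟩
    exact ⟨h1, h2⟩

/-- One more subtraction within stage `j`, shared by the first and the later stages of `euclid`. The
clause on `d` and `a` keeps track of the upper end of the overlap. -/
lemma euclid_aux (hX : X.IsTree) (γ : ℕ → (X ≃g X)) (hI : I.OrdConnected)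
    {m₁ m₂ j q : ℕ} (hj : 1 ≤ j)
    (hq : (q + 1) * euclidSeq m₁ m₂ (j + 1) < euclidSeq m₁ m₂ j)
    (hov : ∃ i, i + 1 ∈ I ∧ i - windowStart m₁ m₂ j (q + 1) ∈ I)
    (ih : q * euclidSeq m₁ m₂ (j + 1) < euclidSeq m₁ m₂ j →
      (∃ i, i + 1 ∈ I ∧ i - windowStart m₁ m₂ j q ∈ I) →
      ∃ c d, AxisPair (γ j * γ (j + 1) ^ (-(q : ℤ))) (γ (j + 1))
        (euclidSeq m₁ m₂ j - q * euclidSeq m₁ m₂ (j + 1)) (euclidSeq m₁ m₂ (j + 1)) c d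
        {i | i ∈ I ∧ i - windowStart m₁ m₂ j q ∈ I} ∧
        ∀ i, i ∈ I → i - windowStart m₁ m₂ j q ∈ I → d i = a i) :
    ∃ c d, AxisPair (γ j * γ (j + 1) ^ (-((q + 1 : ℕ) : ℤ))) (γ (j + 1))
      (euclidSeq m₁ m₂ j - (q + 1 : ℕ) * euclidSeq m₁ m₂ (j + 1)) (euclidSeq m₁ m₂ (j + 1)) c d
      {i | i ∈ I ∧ i - windowStart m₁ m₂ j (q + 1) ∈ I} ∧
      ∀ i, i ∈ I → i - windowStart m₁ m₂ j (q + 1) ∈ I → d i = a i := by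
  have hinv : γ j * γ (j + 1) ^ (-(q : ℤ)) * (γ (j + 1))⁻¹ =
      γ j * γ (j + 1) ^ (-((q + 1 : ℕ) : ℤ)) := by
    rw [mul_assoc, ← zpow_sub_one]
    congr 2
    push_cast
    ring
  have h0 := windowStart_nonneg m₁ m₂ q hj
  rw [windowStart_succ] at hov ⊢
  obtain ⟨c, d, P', hd⟩ := ih (by rw [add_mul] at hq; omega) (by
    obtain ⟨i, h1, h2⟩ := hov
    exact ⟨i, h1, hI.out h2 h1 ⟨by omega, by omega⟩⟩)
  obtain ⟨c', P''⟩ := P'.step_of_shift hX hI h0 (by zify at hq; linarith) hov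
  rw [hinv] at P''
  refine ⟨c', d, ?_, fun i hi hi' => hd i hi (hI.out hi' hi ⟨by omega, by omega⟩)⟩
  convert P'' using 1
  push_cast
  ring

/-- The pairs that occur in the Euclidean algorithm, as long as the overlap is long enough. -/
lemma euclid (hX : X.IsTree) {m₁ m₂ : ℕ} (P : AxisPair g h m₁ m₂ a b I)
    {γ : ℕ → (X ≃g X)} (hγ : γ = elementSeq (euclidQuot m₁ m₂) g h) {j : ℕ} (hj : 1 ≤ j)
    (hjk : j + 1 ≤ euclidLast m₁ m₂) {q : ℕ}
    (hq : q * euclidSeq m₁ m₂ (j + 1) < euclidSeq m₁ m₂ j)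
    (hov : ∃ i, i + 1 ∈ I ∧ i - windowStart m₁ m₂ j q ∈ I) :
    ∃ c d, AxisPair (γ j * γ (j + 1) ^ (-(q : ℤ))) (γ (j + 1))
      (euclidSeq m₁ m₂ j - q * euclidSeq m₁ m₂ (j + 1)) (euclidSeq m₁ m₂ (j + 1)) c d
      {i | i ∈ I ∧ i - windowStart m₁ m₂ j q ∈ I} ∧
      ∀ i, i ∈ I → i - windowStart m₁ m₂ j q ∈ I → d i = a i := by
  have hI := P.ordConnected hX
  induction j, hj using Nat.le_induction generalizing q with
  | base =>
    induction q with
    | zero =>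
      refine ⟨a, b, ?_, fun i hi _ => ((P.mem_iff i).1 hi).symm⟩
      rw [windowStart_one_zero, hγ]
      simpa [elementSeq, euclidSeq] using P
    | succ q ih => exact euclid_aux hX γ hI le_rfl hq hov ih
  | succ j hj ihj =>
    induction q with
    | zero =>
      have hpos := euclidSeq_pos (a := m₁) (b := m₂) (i := j + 2) (by omega) hjk
      have heq := euclidSeq_eq m₁ m₂ hj
      -- The start of stage `j + 1` is the end of stage `j` with the two elements interchanged. All
      -- `euclidQuot m₁ m₂ j` subtractions are allowed because the remainder is positive.
      rw [← windowStart_quot m₁ m₂ hj] at hov ⊢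
      obtain ⟨c, d, P', hd⟩ := ihj (q := euclidQuot m₁ m₂ j) (by omega) (by omega) hov
      refine ⟨d, c, ?_, fun i hi hi' => ((P'.mem_iff i).1 ⟨hi, hi'⟩).trans (hd i hi hi')⟩
      have hγ2 := elementSeq_add_two (euclidQuot m₁ m₂) g h hj
      rw [← hγ] at hγ2
      rw [← hγ2] at P'
      convert P'.symm using 1
      · simp
      · push_cast; ring
      · rw [heq]; push_cast; ring
    | succ q ih => exact euclid_aux hX γ hI (by omega) hq hov ih

end AxisPair

/-! ### The cases of the main theorem -/

lemma IsLine.image_Icc (hX : X.IsTree) {a : ℤ → V} (ha : IsLine X a) {s e : ℤ} (hse : s ≤ e) :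
    a '' Set.Icc s e = segment X (a s) (a e) := by
  ext x
  simp only [segment, Set.mem_ofPred_eq, Set.mem_image, Set.mem_Icc]
  have h0 := ha s e
  constructor
  · rintro ⟨i, hi, rfl⟩
    have h1 := ha s i
    have h2 := ha i e
    omega
  · intro h
    refine ⟨s + X.dist (a s) x, by omega, ?_⟩
    exact (ha.eq_of_dist hX (i := s) (j := e) (by omega) (by omega) (by omega) (by omega)).symm

lemma segment_comm (u v : V) : segment X u v = segment X v u := by
  ext x
  simp only [segment, Set.mem_ofPred_eq]
  rw [X.dist_comm (u := v) (v := x), X.dist_comm (u := v) (v := u), X.dist_comm (u := x) (v := u),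
    add_comm]

lemma IsLine.isEndpoint (hX : X.IsTree) {a : ℤ → V} (ha : IsLine X a) {s e : ℤ} (hse : s ≤ e) :
    IsEndpoint X (a '' Set.Icc s e) (a e) :=
  ⟨a s, by rw [ha.image_Icc hX hse, segment_comm]⟩

namespace AxisPair

variable {g h : X ≃g X} {m n : ℤ} {a b : ℤ → V} {s e : ℤ}

lemma axis_left {I : Set ℤ} (hX : X.IsTree) (P : AxisPair g h m n a b I) :
    axis g = Set.range a :=
  axis_of_shifts hX P.left_pos P.left_line P.left_shifts

lemma isHyperbolic_left {I : Set ℤ} (hX : X.IsTree) (P : AxisPair g h m n a b I) :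
    IsHyperbolic g :=
  isHyperbolic_of_shifts hX P.left_pos P.left_line P.left_shifts

lemma translationLength_left {I : Set ℤ} (hX : X.IsTree) (P : AxisPair g h m n a b I) :
    (translationLength g : ℤ) = m :=
  translationLength_of_shifts hX P.left_pos P.left_line P.left_shifts

lemma axis_inter {I : Set ℤ} (hX : X.IsTree) (P : AxisPair g h m n a b I) {i : ℤ} (h0 : i ∈ I)
    (h1 : i + 1 ∈ I) : axis g ∩ axis h = a '' I := by
  rw [P.axis_left hX, P.symm.axis_left hX, P.range_inter_range h0 h1]

lemma isOverlap (hX : X.IsTree) (P : AxisPair g h m n a b (Set.Icc s e)) (hse : s < e) :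
    IsOverlap g h (a s) (a e) := by
  have hs := (P.mem_iff s).1 ⟨le_rfl, hse.le⟩
  have he := (P.mem_iff e).1 ⟨hse.le, le_rfl⟩
  have hm := P.left_pos
  have hn := P.right_pos
  refine ⟨fun h => ?_, ?_, ?_, ?_⟩
  · have := P.left_line.injective h
    omega
  · rw [P.axis_inter hX (i := s) ⟨le_rfl, hse.le⟩ ⟨by omega, by omega⟩,
      P.left_line.image_Icc hX hse.le]
  · have := P.translationLength_left hX
    rw [TranslatesToward, P.left_shifts, P.left_line, P.left_line]
    omega
  · have := P.symm.translationLength_left hX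
    rw [hs, he, TranslatesToward, P.right_shifts, P.right_line, P.right_line]
    omega

/-- The alternative for an overlap whose length is the translation length of `h`. -/
lemma boundary (hX : X.IsTree) (hfin : ∀ v, (X.neighborSet v).Finite)
    {Γ : Subgroup (X ≃g X)} (hdisc : IsDiscrete Γ) (hinv : InversionFree Γ)
    (P : AxisPair g h m n a b (Set.Icc s e)) (hse : s + n = e) {D : ℕ} (hD : (D : ℤ) = m - n)
    (hΓ : Subgroup.closure {h, g * h⁻¹} = Γ) {l₀ : ℕ∞}
    (hl₀ : l₀ = pathLength X (axis g ∩ h '' axis g)) :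
    ((D : ℕ∞) ≤ 2 * l₀ ∧ ¬ IsFreeGroup Γ ∧ IsElliptic (g * h⁻¹) ∧
        pathLength X (axis h ∩ fixedTree (g * h⁻¹)) = 0 ∧
        2 * setDist X (axis h) (fixedTree (g * h⁻¹)) = D) ∨
      ∃ L : ℕ, l₀ = L ∧ 2 * L < D ∧ FreeOfRankTwo Γ ∧ IsSchottkyPair h (g * h⁻¹) ∧
        IsHyperbolic (g * h⁻¹) ∧ (translationLength (g * h⁻¹) : ℤ) = D - 2 * L ∧
        pathLength X (axis h ∩ axis (g * h⁻¹)) = 0 ∧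
        setDist X (axis h) (axis (g * h⁻¹)) = L := by
  have hn := P.right_pos
  have hb := P.symm.axis_left hX
  have hmem : g * h⁻¹ ∈ Γ := by rw [← hΓ]; exact Subgroup.subset_closure (by simp)
  set J := {i | e ≤ i ∧ a i = h (a (s + e - i))} with hJ
  have hJc : J.OrdConnected := P.ordConnected_return hX
  have heJ : e ∈ J := by
    refine ⟨le_rfl, ?_⟩
    rw [add_sub_cancel_right, (P.mem_iff s).1 ⟨le_rfl, by omega⟩, P.right_shifts, hse,
      (P.mem_iff e).1 ⟨by omega, le_rfl⟩]
  rw [P.axis_left hX, P.range_inter_image hX hse] at hl₀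
  have hlJ : ∀ r : ℕ, (r : ℕ∞) ≤ l₀ ↔ e + r ∈ J := by
    intro r
    rw [hl₀, natCast_le_pathLength_image P.left_line hJc ⟨e, heJ⟩]
    constructor
    · rintro ⟨i, hi, hi'⟩
      exact hJc.out heJ hi' ⟨by omega, by have := hi.1; omega⟩
    · exact fun h => ⟨e, heJ, h⟩
  -- As `l₀` is an integer or infinite, `D ≤ 2 * l₀` amounts to a bound by `D / 2` rounded up.
  by_cases hr : ((((D + 1) / 2 : ℕ) : ℕ∞)) ≤ l₀
  · left
    have hret := ((hlJ _).1 hr).2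
    rw [show s + e - (e + (((D + 1) / 2 : ℕ) : ℤ)) = s - (((D + 1) / 2 : ℕ) : ℤ) by ring] at hret
    obtain ⟨h1, h2, h3, h4⟩ := P.elliptic_of_return hX hse (by omega) (hinv _ hmem)
      (r := (D + 1) / 2) (by omega) hret
    refine ⟨?_, not_isFreeGroup_of_isElliptic hX hfin hdisc hmem h2 ?_, h2, by rw [hb, h3], ?_⟩
    · calc (D : ℕ∞) ≤ ((2 * ((D + 1) / 2) : ℕ) : ℕ∞) := by rw [Nat.cast_le]; omega
        _ = 2 * (((D + 1) / 2 : ℕ) : ℕ∞) := by push_cast; rfl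
        _ ≤ 2 * l₀ := by gcongr
    · intro h1
      have := P.dist_mul_inv_apply hX hse (by omega) (e + 1)
      rw [h1, RelIso.coe_one, id, SimpleGraph.dist_self] at this
      omega
    · rw [hb, h4]
      omega
  · right
    rw [not_le] at hr
    obtain ⟨L, rfl⟩ := ENat.ne_top_iff_exists.1 hr.ne_top
    rw [Nat.cast_lt] at hr
    have hL := ((hlJ L).1 le_rfl).2
    have hL' : e + L + 1 ∉ J := by
      intro h
      have := (hlJ (L + 1)).2 (by push_cast; rwa [← add_assoc])
      rw [Nat.cast_le] at this
      omega
    rw [show s + e - (e + (L : ℤ)) = s - L by ring] at hL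
    obtain ⟨h1, h2, h3, h4⟩ := P.hyperbolic_of_return hX hse (by omega) (L := L) (by omega) hL
      fun h => hL' ⟨by omega, by rw [h]; congr 2; ring⟩
    rw [← hb] at h3 h4
    have hS := isSchottkyPair_of_disjoint_axes hX (P.symm.isHyperbolic_left hX) h1 h3
    exact ⟨L, rfl, by omega, hΓ ▸ hS.freeOfRankTwo, hS, h1, by omega, h3, h4⟩

end AxisPair

lemma ordConnected_and_sub_mem {I : Set ℤ} (hI : I.OrdConnected) (w : ℤ) :
    {i | i ∈ I ∧ i - w ∈ I}.OrdConnected :=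
  ⟨fun _ hi _ hj _ hk => ⟨hI.out hi.1 hj.1 hk, hI.out hi.2 hj.2 ⟨by have := hk.1; omega,
    by have := hk.2; omega⟩⟩⟩

lemma Icc_and_sub_mem {s e w : ℤ} (hw : 0 ≤ w) :
    {i | i ∈ Set.Icc s e ∧ i - w ∈ Set.Icc s e} = Set.Icc (s + w) e := by
  ext i
  simp only [Set.mem_ofPred_eq, Set.mem_Icc]
  omega

namespace AxisPair

variable {γ₁ γ₂ : X ≃g X} {a b : ℤ → V}

/-- The case of an overlap of length at most `m₁ + m₂ - gcd m₁ m₂`. -/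
lemma short_overlap (hX : X.IsTree) (hfin : ∀ v, (X.neighborSet v).Finite)
    {Γ : Subgroup (X ≃g X)} (hΓ : Γ = Subgroup.closure {γ₁, γ₂}) (hdisc : IsDiscrete Γ)
    (hinv : InversionFree Γ) {m₁ m₂ : ℕ} {s e : ℤ} (P : AxisPair γ₁ γ₂ m₁ m₂ a b (Set.Icc s e))
    {L : ℕ} (hL : (L : ℤ) = e - s)
    {m Q : ℕ → ℕ} (hm : m = euclidSeq m₁ m₂) (hQ : Q = euclidQuot m₁ m₂)
    {k : ℕ} (hk : k = euclidLast m₁ m₂) {γ : ℕ → (X ≃g X)} (hγ : γ = elementSeq Q γ₁ γ₂)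
    {j q : ℕ} (hw : InWindow m Q k L j q) :
    ((L : ℤ) = (m₁ : ℤ) + m₂ - m j + q * m (j + 1) ∧
      IsHyperbolic (γ j * γ (j + 1) ^ (-(q : ℤ))) ∧
      ∃ l₀ : ℕ∞,
        l₀ = pathLength X (axis (γ j * γ (j + 1) ^ (-(q : ℤ))) ∩
          γ (j + 1) '' axis (γ j * γ (j + 1) ^ (-(q : ℤ)))) ∧
        ∃ a b : X ≃g X, a = γ (j + 1) ∧ b = γ j * γ (j + 1) ^ (-(q : ℤ) - 1) ∧
          Subgroup.closure {a, b} = Γ ∧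
          IsHyperbolic a ∧ translationLength a = m (j + 1) ∧
          (((m j : ℕ∞) ≤ (q + 1) * m (j + 1) + 2 * l₀ ∧
              ¬ IsFreeGroup Γ ∧ IsElliptic b ∧
              pathLength X (axis a ∩ fixedTree b) = 0 ∧
              (setDist X (axis a) (fixedTree b) : ℚ) =
                ((m j : ℚ) - (q + 1) * m (j + 1)) / 2) ∨
            (∃ L₀ : ℕ, l₀ = L₀ ∧ (L₀ : ℚ) < ((m j : ℚ) - (q + 1) * m (j + 1)) / 2 ∧
              FreeOfRankTwo Γ ∧ IsSchottkyPair a b ∧ IsHyperbolic b ∧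
              (translationLength b : ℤ) = (m j : ℤ) - (q + 1) * m (j + 1) - 2 * L₀ ∧
              pathLength X (axis a ∩ axis b) = 0 ∧
              setDist X (axis a) (axis b) = L₀))) ∨
    ((L : ℤ) < (m₁ : ℤ) + m₂ - m j + q * m (j + 1) ∧
      FreeOfRankTwo Γ ∧
      ∃ a b : X ≃g X, a = γ (j + 1) ∧ b = γ j * γ (j + 1) ^ (-(q : ℤ)) ∧
        Subgroup.closure {a, b} = Γ ∧ IsSchottkyPair a b ∧
        IsHyperbolic a ∧ translationLength a = m (j + 1) ∧
        IsHyperbolic b ∧ (translationLength b : ℤ) = (m j : ℤ) - q * m (j + 1) ∧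
        (∃ N : ℕ, pathLength X (axis a ∩ axis b) = N ∧
          (N : ℤ) = (L : ℤ) - m₁ - m₂ + m j - ((q : ℤ) - 1) * m (j + 1)) ∧
        ∃ vm vp : V, IsOverlap γ₁ γ₂ vm vp ∧ IsEndpoint X (axis a ∩ axis b) vp) := by
  subst hm hQ hk
  rw [inWindow_iff] at hw
  obtain ⟨hj, hjk, hq, hw1, hw2⟩ := hw
  have hnpos := euclidSeq_pos (a := m₁) (b := m₂) (i := j + 1) (by omega) hjk
  have heq := euclidSeq_eq m₁ m₂ hj
  have hle : (q + 1) * euclidSeq m₁ m₂ (j + 1) ≤ euclidSeq m₁ m₂ j := by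
    have : (q + 1) * euclidSeq m₁ m₂ (j + 1) ≤ euclidQuot m₁ m₂ j * euclidSeq m₁ m₂ (j + 1) :=
      Nat.mul_le_mul_right _ hq
    omega
  have hw0 := windowStart_nonneg m₁ m₂ q hj
  have hwq1 := windowStart_succ m₁ m₂ j q
  have hwq2 : windowStart m₁ m₂ j (q + 1) =
      (m₁ : ℤ) + m₂ - euclidSeq m₁ m₂ j + q * euclidSeq m₁ m₂ (j + 1) := by
    simp only [windowStart]
    push_cast
    ring
  have hwq3 : windowStart m₁ m₂ j q =
      (m₁ : ℤ) + m₂ - euclidSeq m₁ m₂ j + (q - 1) * euclidSeq m₁ m₂ (j + 1) := rfl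
  obtain ⟨c, d, P', hd⟩ := P.euclid hX hγ hj hjk (q := q)
    (by rw [add_mul] at hle; omega) ⟨e - 1, ⟨by omega, by omega⟩, ⟨by omega, by omega⟩⟩
  rw [Icc_and_sub_mem hw0] at P'
  set w := windowStart m₁ m₂ j q with hwdef
  have hgen : ∀ z : ℤ, Subgroup.closure {γ (j + 1), γ j * γ (j + 1) ^ z} = Γ := by
    intro z
    rw [closure_pair_mul_zpow, hΓ, hγ, closure_elementSeq _ _ _ hj]
  have hinv' : γ j * γ (j + 1) ^ (-(q : ℤ) - 1) =
      γ j * γ (j + 1) ^ (-(q : ℤ)) * (γ (j + 1))⁻¹ := by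
    rw [mul_assoc, ← zpow_sub_one]
  have hyp1 := P'.isHyperbolic_left hX
  have hyp2 := P'.symm.isHyperbolic_left hX
  have htl1 := P'.translationLength_left hX
  have htl2 := P'.symm.translationLength_left hX
  have hse : s + w < e := by omega
  -- The remaining overlap has length `L - w`, which is at most the translation length of `γ (j +
  -- 1)`: equality is case (2a), strict inequality case (2b).
  rcases hw2.eq_or_lt with hw2 | hw2
  · left
    obtain ⟨D, hD⟩ := Nat.exists_eq_add_of_le hle
    have hDZ : (euclidSeq m₁ m₂ j : ℤ) = (q + 1) * euclidSeq m₁ m₂ (j + 1) + D := by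
      exact_mod_cast hD
    have hDQ : (euclidSeq m₁ m₂ j : ℚ) = (q + 1) * euclidSeq m₁ m₂ (j + 1) + D := by
      exact_mod_cast hD
    have hDE : (euclidSeq m₁ m₂ j : ℕ∞) = (q + 1) * euclidSeq m₁ m₂ (j + 1) + D := by
      exact_mod_cast congrArg (Nat.cast (R := ℕ∞)) hD
    refine ⟨by rw [hw2, hwq2], hyp1, _, rfl, _, _, rfl, rfl, hgen _, hyp2,
      by exact_mod_cast htl2, ?_⟩
    have hgen' := hgen (-(q : ℤ) - 1)
    rw [hinv'] at hgen' ⊢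
    rcases P'.boundary hX hfin hdisc hinv (D := D) (by omega) (by rw [hDZ]; ring) hgen' rfl with
      ⟨h1, h2, h3, h4, h5⟩ | ⟨L₀, h1, h2, h3, h4, h5, h6, h7, h8⟩
    · refine Or.inl ⟨?_, h2, h3, h4, ?_⟩
      · rw [hDE]
        gcongr
      · rw [hDQ, ← h5]
        push_cast
        ring
    · refine Or.inr ⟨L₀, h1, ?_, h3, h4, h5, ?_, h7, h8⟩
      · have : (2 * L₀ : ℚ) < D := by exact_mod_cast h2
        rw [hDQ]
        linarith
      · rw [h6, hDZ]
        ring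
  · right
    have hlt : (euclidSeq m₁ m₂ (j + 1) : ℤ) ≤
        euclidSeq m₁ m₂ j - q * euclidSeq m₁ m₂ (j + 1) := by
      zify at hle
      linarith
    have hS := P'.symm.isSchottkyPair hX hse (by omega) (by omega)
    have haxis := P'.symm.axis_inter hX (i := s + w) ⟨le_rfl, hse.le⟩ ⟨by omega, by omega⟩
    refine ⟨by rw [← hwq2]; exact hw2, hgen (-(q : ℤ)) ▸ hS.freeOfRankTwo, _, _, rfl, rfl, hgen _,
      hS, hyp2, by exact_mod_cast htl2, hyp1, htl1, ⟨(e - (s + w)).toNat, ?_, ?_⟩, a s, a e,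
      P.isOverlap hX (by omega), ?_⟩
    · rw [haxis, pathLength_image_Icc P'.right_line]
    · rw [Int.toNat_of_nonneg (by omega), hL, hwq3]
      ring
    · rw [haxis, ← hd e ⟨by omega, le_rfl⟩ ⟨by omega, by omega⟩]
      exact P'.right_line.isEndpoint hX hse.le

/-- The case of an overlap of length more than `m₁ + m₂ - gcd m₁ m₂`. -/
lemma long_overlap (hX : X.IsTree) (hfin : ∀ v, (X.neighborSet v).Finite)
    {Γ : Subgroup (X ≃g X)} (hΓ : Γ = Subgroup.closure {γ₁, γ₂}) (hdisc : IsDiscrete Γ)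
    {m₁ m₂ : ℕ} {I : Set ℤ} (P : AxisPair γ₁ γ₂ m₁ m₂ a b I) (hle : m₂ ≤ m₁)
    {l : ℕ∞} (hl : l = pathLength X (a '' I)) (hne : I.Nonempty)
    (hlt : ((m₁ + m₂ - Nat.gcd m₁ m₂ : ℕ) : ℕ∞) < l)
    {m Q : ℕ → ℕ} (hm : m = euclidSeq m₁ m₂) (hQ : Q = euclidQuot m₁ m₂)
    {k : ℕ} (hk : k = euclidLast m₁ m₂) {γ : ℕ → (X ≃g X)} (hγ : γ = elementSeq Q γ₁ γ₂) :
    ¬ FreeOfRankTwo Γ ∧ (l ≠ ⊤ → ¬ IsFreeGroup Γ) ∧ (IsFreeGroup Γ ↔ γ (k + 1) = 1) ∧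
      Subgroup.closure {γ k, γ (k + 1)} = Γ ∧
      IsHyperbolic (γ k) ∧ translationLength (γ k) = m k ∧ IsElliptic (γ (k + 1)) ∧
      pathLength X (axis (γ k) ∩ fixedTree (γ (k + 1))) + m₁ + m₂ = l + m k ∧
      (l ≠ ⊤ → ∃ vm vp : V, IsOverlap γ₁ γ₂ vm vp ∧
        IsEndpoint X (axis (γ k) ∩ fixedTree (γ (k + 1))) vp) := by
  have hm₁ : 0 < m₁ := by have := P.left_pos; omega
  have hm₂ : 0 < m₂ := by have := P.right_pos; omega
  have hI := P.ordConnected hX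
  have hgcd : Nat.gcd m₁ m₂ ≤ m₂ := Nat.gcd_le_right _ hm₂
  have hk2 := two_le_euclidLast hm₁ hm₂
  have hmk := euclidSeq_euclidLast hm₁ hm₂
  have hmk0 := euclidSeq_last m₁ m₂
  have hwl := windowStart_last hm₁ hm₂
  subst hm hQ hk
  obtain ⟨j, hj⟩ : ∃ j, euclidLast m₁ m₂ = j + 1 := ⟨euclidLast m₁ m₂ - 1, by omega⟩
  rw [hj] at hk2 hmk hmk0 hwl ⊢
  have hj1 : 1 ≤ j := by omega
  -- The algorithm is halted one subtraction before its end, when both translation lengths equal the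
  -- gcd.
  obtain ⟨q, hq⟩ : ∃ q, euclidQuot m₁ m₂ j = q + 1 :=
    ⟨euclidQuot m₁ m₂ j - 1, by have := one_le_euclidQuot hle hj1 hj.ge; omega⟩
  have heq := euclidSeq_eq m₁ m₂ hj1
  rw [hq, show j + 2 = j + 1 + 1 from rfl, hmk0, add_zero] at heq
  have hnpos := euclidSeq_pos (a := m₁) (b := m₂) (i := j + 1) (by omega) hj.ge
  have hws := windowStart_succ m₁ m₂ j q
  rw [← hq, windowStart_quot m₁ m₂ hj1, hwl, hmk] at hws
  have hw0 := windowStart_nonneg m₁ m₂ q hj1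
  obtain ⟨i, hi, hi'⟩ := (natCast_le_pathLength_image P.left_line hI hne
    (m₁ + m₂ - Nat.gcd m₁ m₂ + 1)).1 (by
      rw [← hl]; push_cast; exact Order.add_one_le_of_lt hlt)
  set W := m₁ + m₂ - Nat.gcd m₁ m₂ with hW
  obtain ⟨c, d, P', hd⟩ := P.euclid hX hγ hj1 hj.ge (q := q)
    (by rw [heq, add_mul]; omega) ⟨i + W, by simpa [add_assoc] using hi',
      hI.out hi hi' ⟨by omega, by omega⟩⟩
  set w := windowStart m₁ m₂ j q with hw
  have hwW : w + euclidSeq m₁ m₂ (j + 1) = W := by omega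
  have hγ2 := elementSeq_add_two (euclidQuot m₁ m₂) γ₁ γ₂ hj1
  rw [← hγ] at hγ2
  have hmul : γ j * γ (j + 1) ^ (-(q : ℤ)) * (γ (j + 1))⁻¹ = γ (j + 1 + 1) := by
    rw [show j + 1 + 1 = j + 2 from rfl, hγ2, hq, mul_assoc, ← zpow_sub_one]
    congr 2
    push_cast
    ring
  have hlen : (euclidSeq m₁ m₂ j - q * euclidSeq m₁ m₂ (j + 1) : ℤ) =
      euclidSeq m₁ m₂ (j + 1) := by
    rw [heq]
    push_cast
    ring
  rw [hlen] at P'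
  have hmemI : ∀ x, i ≤ x → x ≤ i + W + 1 → x ∈ I := fun x h1 h2 =>
    hI.out hi hi' ⟨h1, by push_cast; omega⟩
  have hfix := P'.range_inter_fixedTree hX (i₀ := i + W)
    ⟨hmemI _ (by omega) (by omega), hmemI _ (by omega) (by omega)⟩
    ⟨hmemI _ (by omega) (by omega), hmemI _ (by omega) (by omega)⟩
  rw [hmul, ← P'.symm.axis_left hX] at hfix
  have hset : {x | x ∈ {i | i ∈ I ∧ i - w ∈ I} ∧
      x - euclidSeq m₁ m₂ (j + 1) ∈ {i | i ∈ I ∧ i - w ∈ I}} = {x | x ∈ I ∧ x - W ∈ I} := by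
    ext x
    simp only [Set.mem_ofPred_eq]
    rw [show x - euclidSeq m₁ m₂ (j + 1) - w = x - W by omega]
    constructor
    · rintro ⟨⟨h1, -⟩, -, h2⟩
      exact ⟨h1, h2⟩
    · rintro ⟨h1, h2⟩
      exact ⟨⟨h1, hI.out h2 h1 ⟨by omega, by omega⟩⟩, hI.out h2 h1 ⟨by omega, by omega⟩, h2⟩
  rw [hset] at hfix
  have hell : IsElliptic (γ (j + 1 + 1)) := by
    have : d (i + W) ∈ axis (γ (j + 1)) ∩ fixedTree (γ (j + 1 + 1)) := by
      rw [hfix]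
      exact ⟨_, ⟨hmemI _ (by omega) (by omega), by simpa using hi⟩, rfl⟩
    exact ⟨_, this.2⟩
  have hyp := P'.symm.isHyperbolic_left hX
  have hgen : Subgroup.closure {γ (j + 1), γ (j + 1 + 1)} = Γ := by
    rw [hΓ, hγ, closure_elementSeq _ _ _ (by omega)]
  have hmem : γ (j + 1 + 1) ∈ Γ := by rw [← hgen]; exact Subgroup.subset_closure (by simp)
  have hplen : pathLength X (axis (γ (j + 1)) ∩ fixedTree (γ (j + 1 + 1))) + m₁ + m₂ =
      l + euclidSeq m₁ m₂ (j + 1) := by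
    rw [hfix, hmk, hl]
    rcases ordConnected_int hI hne with ⟨s, e, hse, rfl⟩ | h
    · rw [Icc_and_sub_mem (by omega), pathLength_image_Icc P'.right_line,
        pathLength_image_Icc P.left_line]
      have h1 := hi.1
      have h2 := hi'.2
      norm_cast
      omega
    · rw [pathLength_image_eq_top P'.right_line (ordConnected_and_sub_mem hI _),
        pathLength_image_eq_top P.left_line hI h]
      · simp
      · intro r
        obtain ⟨x, hx, hx'⟩ := h (r + W)
        refine ⟨x + W, ⟨hI.out hx hx' ⟨by omega, by push_cast; omega⟩, by simpa using hx⟩, ?_,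
          hI.out hx hx' ⟨by omega, by push_cast; omega⟩⟩
        convert hx' using 1
        push_cast
        ring
  have hone : γ (j + 1 + 1) = 1 → Γ = Subgroup.zpowers (γ (j + 1)) := by
    intro h
    rw [← hgen, h, Set.pair_comm, Subgroup.closure_insert_one, Subgroup.zpowers_eq_closure]
  have hfree : IsFreeGroup Γ ↔ γ (j + 1 + 1) = 1 := by
    constructor
    · intro h
      by_contra h1
      exact not_isFreeGroup_of_isElliptic hX hfin hdisc hmem hell h1 h
    · intro h
      rw [hone h]
      exact isFreeGroup_zpowers hX hyp
  refine ⟨?_, ?_, hfree, hgen, hyp, by exact_mod_cast P'.symm.translationLength_left hX, hell,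
    hplen, ?_⟩
  · intro h
    have h1 := hone (hfree.1 h.isFreeGroup)
    refine not_freeOfRankTwo_of_commute ?_ h
    rw [h1]
    rintro ⟨_, x, rfl⟩ ⟨_, y, rfl⟩
    exact Subtype.ext (zpow_mul_comm _ x y)
  · intro hltop h
    -- If the elliptic generator were trivial, it would fix the whole axis, and the length formula
    -- would make `l` infinite.
    have h1 : fixedTree (γ (j + 1 + 1)) = Set.univ := by
      rw [hfree.1 h]
      exact Set.eq_univ_of_forall fun _ => rfl
    rw [h1, Set.inter_univ, P'.symm.axis_left hX, ← Set.image_univ,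
      pathLength_image_eq_top P'.right_line Set.ordConnected_univ fun r => ⟨0, trivial, trivial⟩,
      top_add, top_add] at hplen
    exact WithTop.add_ne_top.2 ⟨hltop, ENat.natCast_ne_top _⟩ hplen.symm
  · intro hltop
    rcases ordConnected_int hI hne with ⟨s, e, hse, rfl⟩ | h
    · have h1 := hi.1
      have h2 := hi'.2
      refine ⟨a s, a e, P.isOverlap hX (by omega), ?_⟩
      rw [hfix, Icc_and_sub_mem (by omega), ← hd e ⟨hse, le_rfl⟩ ⟨by omega, by omega⟩]
      exact P'.right_line.isEndpoint hX (by omega)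
    · exact absurd (hl.trans (pathLength_image_eq_top P.left_line hI h)) hltop

end AxisPair

end TreeAut

/-! ### The main theorem: case distinction by the length of the overlap. -/

theorem mainTheorem1 {V : Type*} (X : SimpleGraph V) (hX : X.IsTree)
    (hfin : ∀ v, (X.neighborSet v).Finite)
    (γ₁ γ₂ : X ≃g X) (hγ₁ : IsHyperbolic γ₁) (hγ₂ : IsHyperbolic γ₂)
    (Γ : Subgroup (X ≃g X)) (hΓ : Γ = Subgroup.closure {γ₁, γ₂})
    (hdisc : IsDiscrete Γ) (hinv : InversionFree Γ)
    (m₁ m₂ : ℕ) (hm₁ : m₁ = translationLength γ₁) (hm₂ : m₂ = translationLength γ₂)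
    (hle : m₂ ≤ m₁) (hdir : SameDirection γ₁ γ₂)
    (l : ℕ∞) (hl : l = pathLength X (axis γ₁ ∩ axis γ₂))
    (m Q : ℕ → ℕ) (hm : m = euclidSeq m₁ m₂) (hQ : Q = euclidQuot m₁ m₂)
    (k : ℕ) (hk : k = euclidLast m₁ m₂)
    (γ : ℕ → (X ≃g X)) (hγ : γ = elementSeq Q γ₁ γ₂) :
    -- Case (1)
    (l = 0 ∧ FreeOfRankTwo Γ ∧ IsSchottkyPair γ₁ γ₂) ∨
    -- Case (2)
    (∃ L : ℕ, l = L ∧ 0 < L ∧ (L : ℤ) ≤ (m₁ : ℤ) + m₂ - Nat.gcd m₁ m₂ ∧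
      (∃! p : ℕ × ℕ, InWindow m Q k L p.1 p.2) ∧
      ∀ j q : ℕ, InWindow m Q k L j q →
        -- Case (2a)
        ((L : ℤ) = (m₁ : ℤ) + m₂ - m j + q * m (j + 1) ∧
          IsHyperbolic (γ j * γ (j + 1) ^ (-(q : ℤ))) ∧
          ∃ l₀ : ℕ∞,
            l₀ = pathLength X (axis (γ j * γ (j + 1) ^ (-(q : ℤ))) ∩
              γ (j + 1) '' axis (γ j * γ (j + 1) ^ (-(q : ℤ)))) ∧
            ∃ a b : X ≃g X, a = γ (j + 1) ∧ b = γ j * γ (j + 1) ^ (-(q : ℤ) - 1) ∧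
              Subgroup.closure {a, b} = Γ ∧
              IsHyperbolic a ∧ translationLength a = m (j + 1) ∧
              -- Case (2a)(i), where the condition says `l₀ ≥ (mⱼ - (q + 1) mⱼ₊₁) / 2`
              (((m j : ℕ∞) ≤ (q + 1) * m (j + 1) + 2 * l₀ ∧
                  ¬ IsFreeGroup Γ ∧ IsElliptic b ∧
                  pathLength X (axis a ∩ fixedTree b) = 0 ∧
                  (setDist X (axis a) (fixedTree b) : ℚ) =
                    ((m j : ℚ) - (q + 1) * m (j + 1)) / 2) ∨
              -- Case (2a)(ii)
                (∃ L₀ : ℕ, l₀ = L₀ ∧ (L₀ : ℚ) < ((m j : ℚ) - (q + 1) * m (j + 1)) / 2 ∧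
                  FreeOfRankTwo Γ ∧ IsSchottkyPair a b ∧ IsHyperbolic b ∧
                  (translationLength b : ℤ) = (m j : ℤ) - (q + 1) * m (j + 1) - 2 * L₀ ∧
                  pathLength X (axis a ∩ axis b) = 0 ∧
                  setDist X (axis a) (axis b) = L₀))) ∨
        -- Case (2b)
        ((L : ℤ) < (m₁ : ℤ) + m₂ - m j + q * m (j + 1) ∧
          FreeOfRankTwo Γ ∧
          ∃ a b : X ≃g X, a = γ (j + 1) ∧ b = γ j * γ (j + 1) ^ (-(q : ℤ)) ∧
            Subgroup.closure {a, b} = Γ ∧ IsSchottkyPair a b ∧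
            IsHyperbolic a ∧ translationLength a = m (j + 1) ∧
            IsHyperbolic b ∧ (translationLength b : ℤ) = (m j : ℤ) - q * m (j + 1) ∧
            (∃ N : ℕ, pathLength X (axis a ∩ axis b) = N ∧
              (N : ℤ) = (L : ℤ) - m₁ - m₂ + m j - ((q : ℤ) - 1) * m (j + 1)) ∧
            ∃ vm vp : V, IsOverlap γ₁ γ₂ vm vp ∧ IsEndpoint X (axis a ∩ axis b) vp)) ∨
    -- Case (3), where `l` may be infinite
    (((m₁ + m₂ - Nat.gcd m₁ m₂ : ℕ) : ℕ∞) < l ∧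
      ¬ FreeOfRankTwo Γ ∧ (l ≠ ⊤ → ¬ IsFreeGroup Γ) ∧ (IsFreeGroup Γ ↔ γ (k + 1) = 1) ∧
      Subgroup.closure {γ k, γ (k + 1)} = Γ ∧
      IsHyperbolic (γ k) ∧ translationLength (γ k) = m k ∧ IsElliptic (γ (k + 1)) ∧
      pathLength X (axis (γ k) ∩ fixedTree (γ (k + 1))) + m₁ + m₂ = l + m k ∧
      (l ≠ ⊤ → ∃ vm vp : V, IsOverlap γ₁ γ₂ vm vp ∧
        IsEndpoint X (axis (γ k) ∩ fixedTree (γ (k + 1))) vp)) := by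
  by_cases hl0 : l = 0
  · left
    have hS := isSchottkyPair_of_disjoint_axes hX hγ₁ hγ₂ (hl.symm.trans hl0)
    exact ⟨hl0, hΓ ▸ hS.freeOfRankTwo, hS⟩
  right
  obtain ⟨a, b, I, P, i₀, h0, h1⟩ := exists_axisPair hX hγ₁ hγ₂ hdir (hl ▸ hl0)
  rw [← hm₁, ← hm₂] at P
  rw [P.axis_inter hX h0 h1] at hl
  have hm₁pos : 0 < m₁ := by have := P.left_pos; omega
  have hm₂pos : 0 < m₂ := by have := P.right_pos; omega
  -- Thus the truncated subtraction in the bound of case (3) agrees with the integer one in case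
  -- (2).
  have hgcd : Nat.gcd m₁ m₂ ≤ m₂ := Nat.gcd_le_right _ hm₂pos
  rcases lt_or_ge ((m₁ + m₂ - Nat.gcd m₁ m₂ : ℕ) : ℕ∞) l with hlt | hge
  · right
    exact ⟨hlt, P.long_overlap hX hfin hΓ hdisc hle hl ⟨i₀, h0⟩ hlt hm hQ hk hγ⟩
  · left
    obtain ⟨L, rfl⟩ := ENat.ne_top_iff_exists.1 (hge.trans_lt (ENat.natCast_lt_top _)).ne
    rw [Nat.cast_le] at hge
    have hL0 : 0 < L := Nat.pos_of_ne_zero fun h => hl0 (by simp [h])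
    have hL : (L : ℤ) ≤ (m₁ : ℤ) + m₂ - Nat.gcd m₁ m₂ := by omega
    rcases ordConnected_int (P.ordConnected hX) ⟨i₀, h0⟩ with ⟨s, e, hse, rfl⟩ | h
    · rw [pathLength_image_Icc P.left_line, Nat.cast_inj] at hl
      refine ⟨L, rfl, hL0, hL, ?_, fun j q hw =>
        P.short_overlap hX hfin hΓ hdisc hinv (by omega) hm hQ hk hγ hw⟩
      rw [hm, hQ, hk]
      exact existsUnique_inWindow hm₁pos hm₂pos hL0 hL
    · rw [pathLength_image_eq_top P.left_line (P.ordConnected hX) h] at hl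
      exact absurd hl (ENat.natCast_ne_top L)
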